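/- Let $D$ be an unoriented link diagram with $c$ ordered crossings. For a Kauffman state $s\colon \mathrm{cr}(D)\to\{A,B\}$ let $sD$ be the system of circles and chords obtained by smoothing every crossing according to its label, leaving a chord at each crossing ($A$: the two regions swept by the overpassing strand rotated counterclockwise are joined), $|s|$ its number of circles, and $\sigma(s)=|s^{-1}(A)|-|s^{-1}(B)|$. An enhanced state is a state $s$ with a sign $\pm1$ on every circle of $sD$; let $\tau(s)$ be the sum of the signs, $i(s)=\sigma(s)$ and $j(s)=\sigma(s)+2\tau(s)$. Let $C_{i,j}(D)$ be the free abelian group on the enhanced states with $i(s)=i$, $j(s)=j$, and $\partial(s)=\sum_t (s:t)\,t$, where $(s:t)=(-1)^k$ if $i(t)=i(s)-2$, $j(t)=j(s)$, $s$ and $t$ have the same labels except at one crossing $x$, labelled $A$ in $s$ and $B$ in $t$, and the circles not passing through $x$ have the same signs in $s$ and $t$; here $k$ is the number of $B$-labelled crossings of $s$ after $x$. Otherwise $(s:t)=0$. Let $H_{i,j}(D)=\ker(\partial\colon C_{i,j}\to C_{i-2,j})/\operatorname{im}(\partial\colon C_{i+2,j}\to C_{i,j})$ be the (framed) Khovanov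 homology. Let $j_{\max}(D)=\max_s j(s)$ and $j_{\mathrm{almax}}(D)=j_{\max}(D)-4$; the groups $H_{i,j_{\mathrm{almax}}}(D)$ are the almost-extreme Khovanov homology groups. Let $s_A$ be the state with all labels $A$, and let $G=G_A(D)$ be the multigraph whose vertices are the circles of $s_AD$ and whose edges are the chords (one for each crossing). $D$ is $A$-adequate if $G$ has no loops. Let $p_1$ be the cyclomatic number of the simple graph obtained from $G$ by replacing each multiedge by a single edge. The partial presimplicial set $\mathcal X_D$ has as simplices of dimension $c-1$ the vertices $T$ of $G$, and as simplices of dimension $k<c-1$ the increasing sequences $(w_0,\dots,w_k)$ of $k+1$ edges $v_0<\dots<v_{c-1}$ of $G$ such that all the other edges connect the same pair of vertices (for $k=-1$ the empty sequence is included if it satisfies this condition). The face $d_i(T)$ is $(v_0,\dots,\widehat{v_i},\dots,v_{c-1})$ if $v_i$ is incident to $T$, and $0$ otherwise; the face $d_i(w_0,\dots,w_k)$ is $(w_0,\dots,\widehat{w_i},\dots,w_k)$ if $w_i$ connects the same pair of vertices as the edges not in the sequence, and $0$ otherwise. Let $\widetilde H_k(\mathcal X_D)$ be the homology of the chain complex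 freely generated by the simplices, with $\partial=\sum_i(-1)^id_i$; this complex is the reduced cellular chain complex of the geometric realization $|\mathcal X_D|$. **Corollary.** Let $D$ be a connected (in particular non-empty) $A$-adequate link diagram with $c\ge 0$ crossings. Then $j_{\mathrm{almax}}(D)=c+2|s_A|-4$, and the almost-extreme Khovanov homology is the reduced homology of $\mathcal X_D$: $H_{2k+2-c,\;j_{\mathrm{almax}}}(D)\cong\widetilde H_k(\mathcal X_D)$ for all $k\ge-1$. Moreover: (i) If $G$ is bipartite, then $H_{c,\,c+2|s_A|-4}(D)\cong\mathbb Z$, $H_{c-2,\,c+2|s_A|-4}(D)\cong\mathbb Z^{p_1}$, and $H_{i,\,c+2|s_A|-4}(D)=0$ for all other $i$. (ii) If $G$ contains a cycle of odd length, then $p_1\ge1$, $H_{c-2,\,c+2|s_A|-4}(D)\cong\mathbb Z^{p_1-1}\oplus\mathbb Z_2$, and $H_{i,\,c+2|s_A|-4}(D)=0$ for all $i\ne c-2$. -/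

import Mathlib

/-- A half-edge (dart) of a diagram with `c` crossings: the half-edge number `k` at the crossing
`x`.  The four half-edges at a crossing are numbered `0, 1, 2, 3` counterclockwise, in such a way
that `0, 2` belong to the underpassing strand and `1, 3` to the overpassing strand. -/
abbrev Dart (c : ℕ) : Type := Fin c × Fin 4

/-- An unoriented link diagram on the sphere, with ordered crossings `0 < 1 < ⋯ < c - 1`, encoded
as a planar combinatorial map (planar diagram code): `arc` tells how the half-edges at the
crossings are joined in pairs to form the arcs of the diagram, and `freeCircles` is the number of
simple closed curves without crossings.  The last field is Euler's formula `V - E + F = 2 k` for the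
4-valent graph with `V = c` crossings, `E = 2 c` arcs and `k` connected components; it says that
every component of that graph, with its cyclic orders at the crossings, lies on a sphere.  The
`F` faces are the orbits of "cross the arc, then turn to the next half-edge". -/
structure LinkDiagram where
  /-- the number of crossings -/
  c : ℕ
  /-- the other half-edge of the arc that contains a given half-edge -/
  arc : Dart c → Dart c
  arc_arc : ∀ d, arc (arc d) = d
  arc_ne : ∀ d, arc d ≠ d
  /-- the number of components of the diagram that have no crossing -/
  freeCircles : ℕ
  planar :
    Nat.card (Quot fun d d' : Dart c => d' = ((arc d).1, (arc d).2 + 1)) =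
      c + 2 * Nat.card (Quot fun d d' : Dart c => d' = arc d ∨ d'.1 = d.1)

/-- The two labels (markers) of a crossing. -/
inductive Label : Type
  | A
  | B
  deriving DecidableEq

instance : Fintype Label := ⟨{Label.A, Label.B}, fun x => by cases x <;> simp⟩

noncomputable section

namespace LinkDiagram

variable (D : LinkDiagram)

/-- The connected components of the diagram, as a subset of the sphere. -/
abbrev Piece : Type :=
  (Quot fun d d' : Dart D.c => d' = D.arc d ∨ d'.1 = d.1) ⊕ Fin D.freeCircles

/-- The diagram is connected (in particular, not empty). -/
def Connected : Prop := Nat.card D.Piece = 1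

/-- A Kauffman state. -/
abbrev State : Type := Fin D.c → Label

/-- The half-edge to which a smoothing joins the half-edge `k` of a crossing.  The `A`-smoothing
opens a channel between the two regions swept by the overpassing strand when it is rotated
counterclockwise (those between `1, 2` and between `3, 0`), so it joins `0` to `1` and `2` to `3`;
the `B`-smoothing joins `1` to `2` and `3` to `0`. -/
def smoothing : Label → Fin 4 → Fin 4
  | Label.A => ![1, 0, 3, 2]
  | Label.B => ![3, 2, 1, 0]

variable {D} in
/-- Two half-edges follow each other on a circle of `sD`. -/
def CircleStep (s : D.State) (d d' : Dart D.c) : Prop :=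
  d' = D.arc d ∨ d' = (d.1, smoothing (s d.1) d.2)

variable {D} in
/-- The circles of `sD`. -/
abbrev Circle (s : D.State) : Type := Quot (CircleStep s) ⊕ Fin D.freeCircles

variable {D} in
/-- The circle of `sD` through a half-edge. -/
def circleOf (s : D.State) (d : Dart D.c) : Circle s := Sum.inl (Quot.mk _ d)

instance (s : D.State) : Fintype (Circle s) := Fintype.ofFinite _

/-- An enhanced state: a state `s` with a sign for each circle of `sD`. -/
abbrev EnhancedState : Type := (s : D.State) × (Circle s → ℤˣ)

instance : Fintype D.EnhancedState := Fintype.ofFinite _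

variable {D} in
/-- `σ(s) = |s⁻¹(A)| - |s⁻¹(B)|`. -/
def sigma (s : D.State) : ℤ :=
  ((Finset.univ.filter fun x => s x = Label.A).card : ℤ) -
    ((Finset.univ.filter fun x => s x = Label.B).card : ℤ)

variable {D} in
/-- `τ(S)`, the sum of the signs. -/
def tau (S : D.EnhancedState) : ℤ := ∑ C : Circle S.1, ((S.2 C : ℤˣ) : ℤ)

variable {D} in
/-- The index `i(S) = σ(S)`. -/
def iIndex (S : D.EnhancedState) : ℤ := sigma S.1

variable {D} in
/-- The index `j(S) = σ(S) + 2 τ(S)`. -/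
def jIndex (S : D.EnhancedState) : ℤ := sigma S.1 + 2 * tau S

variable {D} in
/-- `T` is adjacent to `S`, and `x` is the crossing at which their labels differ.  The common
circles of the two smoothings are those that do not pass through `x`. -/
def AdjacentAt (S T : D.EnhancedState) (x : Fin D.c) : Prop :=
  iIndex T = iIndex S - 2 ∧ jIndex T = jIndex S ∧
    S.1 x = Label.A ∧ T.1 x = Label.B ∧ (∀ y, y ≠ x → S.1 y = T.1 y) ∧
    (∀ d : Dart D.c, (∀ k, circleOf S.1 (x, k) ≠ circleOf S.1 d) →
      S.2 (circleOf S.1 d) = T.2 (circleOf T.1 d)) ∧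
    ∀ f : Fin D.freeCircles, S.2 (Sum.inr f) = T.2 (Sum.inr f)

open Classical in
variable {D} in
/-- The incidence number `(S : T)`: it is `(-1) ^ k` if `T` is adjacent to `S`, where `k` is the
number of `B`-labelled crossings of `S` after the crossing at which they differ, and `0`
otherwise.  (At most one summand is not zero.) -/
def incidence (S T : D.EnhancedState) : ℤ :=
  ∑ x : Fin D.c, if AdjacentAt S T x then
    (-1) ^ (Finset.univ.filter fun y => x < y ∧ S.1 y = Label.B).card else 0

/-- The enhanced states that generate `C_{i,j}(D)`. -/
abbrev Generator (i j : ℤ) : Type := {S : D.EnhancedState // iIndex S = i ∧ jIndex S = j}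

instance (i j : ℤ) : Fintype (D.Generator i j) := Fintype.ofFinite _

/-- The chain group `C_{i,j}(D)`. -/
abbrev Chain (i j : ℤ) : Type := D.Generator i j →₀ ℤ

/-- The differential `S ↦ ∑ T, (S : T) T` as a map `C_{i,j}(D) → C_{i',j}(D)`; it is used for
`i' = i - 2` only. -/
def differential (i i' j : ℤ) : D.Chain i j →ₗ[ℤ] D.Chain i' j :=
  Finsupp.lift (D.Chain i' j) ℤ (D.Generator i j) fun S =>
    ∑ T : D.Generator i' j, Finsupp.single T (incidence S.1 T.1)

/-- The (framed) Khovanov homology group `H_{i,j}(D) = ker ∂_{i,j} / im ∂_{i+2,j}`. -/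
abbrev Homology (i j : ℤ) : Type :=
  LinearMap.ker (D.differential i (i - 2) j) ⧸
    (LinearMap.range (D.differential (i + 2) i j)).submoduleOf
      (LinearMap.ker (D.differential i (i - 2) j))

/-- `j_max(D)`, the maximum of `j` over the (finitely many) enhanced states. -/
def jMax : ℤ := ⨆ S : D.EnhancedState, jIndex S

/-- `j_almax(D) = j_max(D) - 4`. -/
def jAlmax : ℤ := D.jMax - 4

variable {D} in
/-- The state graph `G_s(D)`: the vertices are the circles of `sD`, the edges are the crossings,
and the edge `x` connects the circles at the two ends of the chord at `x`.  For each of the two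
labels, the half-edges `0` and `2` lie on the two different sides of the smoothed crossing. -/
def stateGraph (s : D.State) : Graph (Circle s) (Fin D.c) where
  vertexSet := Set.univ
  edgeSet := Set.univ
  IsLink x u v := s(u, v) = s(circleOf s (x, 0), circleOf s (x, 2))
  isLink_symm x _ := ⟨fun u v h => by rw [Sym2.eq_swap]; exact h⟩
  eq_or_eq_of_isLink_of_isLink x u v u' v' h h' := by
    rw [← h', Sym2.eq_iff] at h
    rcases h with h | h
    · exact Or.inl h.1
    · exact Or.inr h.1
  edge_mem_iff_exists_isLink x := by
    simp only [Set.mem_univ, true_iff]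
    exact ⟨_, _, rfl⟩
  left_mem_of_isLink _ _ _ _ := Set.mem_univ _

/-- The state `s_A`. -/
def stateA : D.State := fun _ => Label.A

/-- The number `|s_A|` of circles of `s_A D`. -/
def numCirclesA : ℕ := Nat.card (Circle D.stateA)

/-- The graph `G_A(D)`. -/
def graphA : Graph (Circle D.stateA) (Fin D.c) := stateGraph D.stateA

/-- `D` is `A`-adequate: `G_A(D)` has no loops. -/
def AAdequate : Prop := D.graphA.Loopless

end LinkDiagram

/-- The multigraph `G` is bipartite. -/
def IsBipartiteGraph {V E : Type*} (G : Graph V E) : Prop :=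
  ∃ f : V → Bool, ∀ e u v, G.IsLink e u v → f u ≠ f v

/-- The multigraph `G` contains a cycle of odd length: `n` different vertices and `n` different
edges in cyclic order, where the edge number `k` connects the vertices number `k` and `k + 1`. -/
def HasOddCycle {V E : Type*} (G : Graph V E) : Prop :=
  ∃ n : ℕ, Odd n ∧ ∃ (v : ZMod n → V) (e : ZMod n → E),
    Function.Injective v ∧ Function.Injective e ∧ ∀ k, G.IsLink (e k) (v k) (v (k + 1))

/-- The cyclomatic number `|E| - |V| + (number of components)` of a finite simple graph.  (The
subtraction is never truncated.) -/
def cyclomaticNumber {V : Type*} (H : SimpleGraph V) : ℕ :=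
  Nat.card H.edgeSet + Nat.card H.ConnectedComponent - Nat.card V

/-! ### The partial presimplicial set of a loopless graph with ordered edges -/

namespace PartialPresimplicial

variable {V : Type} {c : ℕ} (G : Graph V (Fin c))

/-- All the edges of `G` outside `w` connect the same pair of vertices. -/
def ParallelOutside (w : Finset (Fin c)) : Prop :=
  ∃ u v, ∀ e ∉ w, G.IsLink e u v

/-- The simplices with `q` vertices, that is, of dimension `q - 1`, of the partial presimplicial
set of a loopless graph `G` with edges `v_0 < ⋯ < v_{c-1}`.  Those of dimension `c - 1` are the
vertices of `G`.  Those of smaller dimension `k` are the increasing sequences of `k + 1` edges such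
that all the other edges are parallel.  The case `q = 0` is the augmentation: the empty sequence
is allowed exactly if all the edges of `G` are parallel. -/
inductive Simplex (q : ℕ) : Type
  | top (hq : q = c) (T : V) (hT : T ∈ G.vertexSet) : Simplex q
  | sub (hq : q < c) (w : Finset (Fin c)) (hw : w.card = q) (hpar : ParallelOutside G w) : Simplex q

variable {G}

/-- Removing an edge from a set of `q + 1` edges. -/
theorem card_erase_aux {q : ℕ} {w : Finset (Fin c)} (hw : w.card = q + 1) (i : Fin (q + 1)) :
    (w.erase (w.orderEmbOfFin hw i)).card = q := by
  rw [Finset.card_erase_of_mem (Finset.orderEmbOfFin_mem w hw i), hw]; rfl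

theorem parallel_erase_aux {e : Fin c} {T : V} (h : G.Inc e T) :
    ParallelOutside G (Finset.univ.erase e) := by
  obtain ⟨y, hy⟩ := h
  refine ⟨T, y, fun f hf => ?_⟩
  have : f = e := by simpa using hf
  exact this ▸ hy

open Classical in
/-- The partially defined face maps `d_i`; `none` stands for "undefined" (or zero).
`d_i(T)` omits the edge `v_i` if `v_i` is incident to `T`, and
`d_i(w_0, …, w_k)` omits `w_i` if `w_i` is parallel to the edges outside `w`. -/
def face {q : ℕ} (i : Fin (q + 1)) : Simplex G (q + 1) → Option (Simplex G q)
  | Simplex.top hq T _ =>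
    if h : G.Inc (Fin.cast hq i) T then
      some (Simplex.sub (by omega) (Finset.univ.erase (Fin.cast hq i))
        (by simp [← hq]) (parallel_erase_aux h))
    else none
  | Simplex.sub hq w hw _ =>
    if h : ParallelOutside G (w.erase (w.orderEmbOfFin hw i)) then
      some (Simplex.sub (by omega) (w.erase (w.orderEmbOfFin hw i)) (card_erase_aux hw i) h)
    else none

variable (G)

/-- The boundary `∂ = ∑ (-1)^i d_i`, where `d_i` is zero where it is undefined. -/
def boundary (q : ℕ) : (Simplex G (q + 1) →₀ ℤ) →ₗ[ℤ] (Simplex G q →₀ ℤ) :=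
  Finsupp.lift (Simplex G q →₀ ℤ) ℤ (Simplex G (q + 1)) fun a =>
    ∑ i : Fin (q + 1), (-1 : ℤ) ^ (i : ℕ) •
      ((face i a).elim (0 : Simplex G q →₀ ℤ) fun b => Finsupp.single b 1)

/-- The cycles in dimension `q - 1`. -/
def cycles : (q : ℕ) → Submodule ℤ (Simplex G q →₀ ℤ)
  | 0 => ⊤
  | q + 1 => LinearMap.ker (boundary G q)

/-- The homology in dimension `q - 1` of the chain complex of the partial presimplicial set of
`G`.  This complex is the reduced cellular chain complex of the geometric realization: if some face
map is undefined, the realization has, besides one cell for each simplex, the base point as a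
further 0-cell and there is no empty simplex; otherwise there is no extra point, and the empty
simplex augments the complex. -/
abbrev Homology (q : ℕ) : Type :=
  cycles G q ⧸ (LinearMap.range (boundary G q)).submoduleOf (cycles G q)

end PartialPresimplicial

end

/-!
The almost-extreme chain complex is small.  An enhanced state in degree `j_max - 4` is either the
state `s_A` with one negative circle, or a state with positive circles whose `B`-labelled crossings
form a non-empty set of parallel edges of `G = G_A(D)`.  These are the simplices of the partial
presimplicial set, so the two complexes have the same bases, and their differentials agree up to a
change of signs of the basis elements (`simplexSign_mul`, `homologyEquiv`).

The classification needs the numbers of circles of all states.  Here planarity enters, in the form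
of a mod 2 Jordan curve theorem (`exists_face_coloring`): for a diagram that satisfies Euler's
formula, every mod 2 cycle of arcs is the boundary of a set of faces, because both spaces have the
same dimension.  Two strands through opposite half-edges of a crossing would cross exactly once
(`Strand.not_opposite`), so changing a label from `A` to `B` joins two circles or splits one
(`merge_or_merge`).  Since `D` is `A`-adequate, the first change joins two circles.  Further chords
between the same two circles lie in the annulus between them and do not interlace, so each of them
splits a circle (`not_interlaced`, `card_circle_of_parallel`); a chord between other circles joins
circles once more, which costs four units of `j` (`card_circle_of_not_parallel`).

The homology of the partial presimplicial set is computed directly.  The simplices below the top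
dimension form, for each parallel class, the cochain complex of a full simplex whose vertices are
the edges of the class, and an edge chosen in each class provides a contraction
(`subsingleton_homology_of_lt`).  So only the cochains of degree zero contribute, as the functions
on the parallel classes, and what remains are the kernel and the cokernel of the transposed
unsigned incidence matrix of the simple graph of `G` (`homology_top`, `homology_next`).  If the
graph is connected and bipartite, a change of signs turns this matrix into the coboundary, with
kernel `ℤ` and with free cokernel.  If it is connected and not bipartite, the kernel vanishes and
the torsion of the cokernel is generated by the class of the constant function `1`, which has
order 2 (`Connected.unsignedIncidence_of_bipartite`,
`Connected.unsignedIncidence_of_not_bipartite`). -/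

/-! ### A mod 2 Jordan curve theorem -/

namespace LinkDiagram

variable (D : LinkDiagram)

/-- The equivalence relation on half-edges whose classes are the arcs of the diagram. -/
def arcSetoid : Setoid (Dart D.c) where
  r d d' := d' = d ∨ d' = D.arc d
  iseqv := by
    refine ⟨fun d => Or.inl rfl, ?_, ?_⟩
    · rintro d d' (rfl | rfl)
      · exact Or.inl rfl
      · exact Or.inr (D.arc_arc _).symm
    · rintro d d' d'' (rfl | rfl) (rfl | rfl)
      · exact Or.inl rfl
      · exact Or.inr rfl
      · exact Or.inr rfl
      · exact Or.inl (D.arc_arc _)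

theorem arcSetoid_mk_eq_iff (d d' : Dart D.c) :
    Quotient.mk D.arcSetoid d' = Quotient.mk D.arcSetoid d ↔ d' = d ∨ d' = D.arc d := by
  rw [eq_comm, Quotient.eq]; rfl

open Classical in
theorem filter_arcSetoid (d : Dart D.c) :
    Finset.univ.filter (fun d' => Quotient.mk D.arcSetoid d' = Quotient.mk D.arcSetoid d) =
      {d, D.arc d} := by
  ext d'
  simp [arcSetoid_mk_eq_iff]

theorem card_arcs : Nat.card (Quotient D.arcSetoid) = 2 * D.c := by
  classical
  have h := Finset.card_eq_sum_card_fiberwise (s := (Finset.univ : Finset (Dart D.c)))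
    (t := (Finset.univ : Finset (Quotient D.arcSetoid)))
    (f := Quotient.mk D.arcSetoid) (fun _ _ => Finset.mem_univ _)
  have h2 : ∀ e ∈ (Finset.univ : Finset (Quotient D.arcSetoid)),
      (Finset.univ.filter fun d => Quotient.mk D.arcSetoid d = e).card = 2 := by
    intro e _
    induction e using Quotient.inductionOn with
    | h d => rw [filter_arcSetoid, Finset.card_pair (D.arc_ne d).symm]
  rw [Finset.sum_congr rfl h2] at h
  simp at h
  rw [Nat.card_eq_fintype_card]
  omega

/-- The half-edge that follows `d` on the boundary of its face. -/
abbrev FaceStep (d d' : Dart D.c) : Prop := d' = ((D.arc d).1, (D.arc d).2 + 1)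

/-- The faces of the diagram. -/
abbrev Face : Type := Quot D.FaceStep

/-- Two half-edges belong to the same arc or to the same crossing. -/
abbrev PieceStep (d d' : Dart D.c) : Prop := d' = D.arc d ∨ d'.1 = d.1

/-- The components of the 4-valent graph underlying the diagram. -/
abbrev GraphPiece : Type := Quot D.PieceStep

/-- The component that contains a face. -/
def Face.piece : D.Face → D.GraphPiece :=
  Quot.lift (fun d => Quot.mk _ d) (by
    rintro d d' rfl
    exact (Quot.sound (r := D.PieceStep) (Or.inl rfl)).trans
      (Quot.sound (r := D.PieceStep) (Or.inr rfl)))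

/-- The mod 2 cycles of the 4-valent graph, as functions on half-edges. -/
def cycleSpace : Submodule (ZMod 2) (Dart D.c → ZMod 2) where
  carrier := {a | (∀ d, a (D.arc d) = a d) ∧ ∀ x, ∑ k, a (x, k) = 0}
  add_mem' := by
    rintro a b ⟨ha, ha'⟩ ⟨hb, hb'⟩
    exact ⟨fun d => by simp [ha, hb], fun x => by simp [Finset.sum_add_distrib, ha', hb']⟩
  zero_mem' := by simp
  smul_mem' := by
    rintro r a ⟨ha, ha'⟩
    exact ⟨fun d => by simp [ha], fun x => by
      simp only [Pi.smul_apply, ← Finset.smul_sum, ha', smul_zero]⟩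

/-- The mod 2 boundary of a set of faces: the arcs that have exactly one side in the set.  The face
of the half-edge `(x, k)` contains the corner between the half-edges `k - 1` and `k` at `x`. -/
def faceBoundary : (D.Face → ZMod 2) →ₗ[ZMod 2] (Dart D.c → ZMod 2) where
  toFun h d := h (Quot.mk _ d) + h (Quot.mk _ (d.1, d.2 + 1))
  map_add' h h' := by ext d; simp; ring
  map_smul' r h := by ext d; simp; ring

theorem face_mk_arc_succ (d : Dart D.c) :
    (Quot.mk _ ((D.arc d).1, (D.arc d).2 + 1) : D.Face) = Quot.mk _ d :=
  (Quot.sound (r := D.FaceStep) rfl).symm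

theorem face_mk_arc (d : Dart D.c) :
    (Quot.mk _ (D.arc d) : D.Face) = Quot.mk _ (d.1, d.2 + 1) := by
  have := D.face_mk_arc_succ (D.arc d)
  rw [D.arc_arc] at this
  exact this.symm

theorem range_faceBoundary_le : LinearMap.range D.faceBoundary ≤ D.cycleSpace := by
  rintro _ ⟨h, rfl⟩
  refine ⟨fun d => ?_, fun x => ?_⟩
  · simp only [faceBoundary, LinearMap.coe_mk, AddHom.coe_mk, face_mk_arc, face_mk_arc_succ]
    ring
  · simp only [faceBoundary, LinearMap.coe_mk, AddHom.coe_mk, Fin.sum_univ_four]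
    have h2 : ∀ t : ZMod 2, t + t = 0 := CharTwo.add_self_eq_zero
    have e1 : (0 : Fin 4) + 1 = 1 := rfl
    have e2 : (1 : Fin 4) + 1 = 2 := rfl
    have e3 : (2 : Fin 4) + 1 = 3 := rfl
    have e4 : (3 : Fin 4) + 1 = 0 := rfl
    rw [e1, e2, e3, e4]
    linear_combination h2 (h (Quot.mk _ (x, 0))) + h2 (h (Quot.mk _ (x, 1))) +
      h2 (h (Quot.mk _ (x, 2))) + h2 (h (Quot.mk _ (x, 3)))

/-- A function on faces without boundary takes the same value on all the faces of a component. -/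
theorem finrank_ker_faceBoundary_le :
    Module.finrank (ZMod 2) (LinearMap.ker D.faceBoundary) ≤ Nat.card D.GraphPiece := by
  have hle : LinearMap.ker D.faceBoundary ≤
      LinearMap.range (LinearMap.funLeft (ZMod 2) (ZMod 2) (Face.piece D)) := by
    intro h hh
    have h1 : ∀ x k, h (Quot.mk _ (x, k + 1)) = h (Quot.mk _ (x, k)) := by
      intro x k
      have := congrFun (LinearMap.mem_ker.1 hh) (x, k)
      exact (CharTwo.add_eq_zero.1 this).symm
    have h2 : ∀ x k, h (Quot.mk _ (x, k)) = h (Quot.mk _ (x, 0)) := by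
      intro x k
      fin_cases k
      · rfl
      · exact h1 x 0
      · exact (h1 x 1).trans (h1 x 0)
      · exact ((h1 x 2).trans (h1 x 1)).trans (h1 x 0)
    refine ⟨Quot.lift (fun d => h (Quot.mk _ d)) ?_, ?_⟩
    · rintro ⟨x, k⟩ d' (rfl | hd)
      · rw [face_mk_arc, h1]
      · obtain ⟨x', k'⟩ := d'
        obtain rfl : x' = x := hd
        rw [h2 x' k, h2 x' k']
    · ext f
      induction f using Quot.ind with
      | mk d => rfl
  calc _ ≤ Module.finrank (ZMod 2) (LinearMap.range
        (LinearMap.funLeft (ZMod 2) (ZMod 2) (Face.piece D))) := Submodule.finrank_mono hle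
    _ ≤ Module.finrank (ZMod 2) (D.GraphPiece → ZMod 2) := LinearMap.finrank_range_le _
    _ = _ := by
      have := Fintype.ofFinite D.GraphPiece
      rw [Module.finrank_fintype_fun_eq_card, Nat.card_eq_fintype_card]

open Classical in
/-- The incidence matrix between crossings and arcs. -/
noncomputable def arcMatrix : Matrix (Fin D.c) (Quotient D.arcSetoid) (ZMod 2) :=
  fun x e => ∑ k, if Quotient.mk D.arcSetoid (x, k) = e then 1 else 0

theorem arcMatrix_mulVec [Fintype (Quotient D.arcSetoid)] (a : Quotient D.arcSetoid → ZMod 2)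
    (x : Fin D.c) :
    D.arcMatrix.mulVec a x = ∑ k, a (Quotient.mk D.arcSetoid (x, k)) := by
  classical
  simp only [Matrix.mulVec, dotProduct, arcMatrix, Finset.sum_mul]
  rw [Finset.sum_comm]
  simp

theorem arcMatrix_transpose_mulVec (f : Fin D.c → ZMod 2) (d : Dart D.c) :
    D.arcMatrix.transpose.mulVec f (Quotient.mk D.arcSetoid d) = f d.1 + f (D.arc d).1 := by
  classical
  simp only [Matrix.mulVec, dotProduct, arcMatrix, Matrix.transpose_apply, Finset.sum_mul]
  rw [← Fintype.sum_prod_type' (f := fun (x : Fin D.c) (k : Fin 4) =>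
    (if Quotient.mk D.arcSetoid (x, k) = Quotient.mk D.arcSetoid d then (1 : ZMod 2) else 0) * f x)]
  simp only [ite_mul, one_mul, zero_mul]
  rw [← Finset.sum_filter]
  rw [filter_arcSetoid, Finset.sum_pair (D.arc_ne d).symm]

/-- The cycle space is the kernel of the incidence matrix between crossings and arcs.  The kernel of
the transposed matrix consists of functions that are constant on components, which bounds the rank
from below. -/
theorem finrank_cycleSpace_le :
    Module.finrank (ZMod 2) D.cycleSpace ≤ D.c + Nat.card D.GraphPiece := by
  classical
  have := Fintype.ofFinite (Quotient D.arcSetoid)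
  have := Fintype.ofFinite D.GraphPiece
  have hker : Module.finrank (ZMod 2) (LinearMap.ker D.arcMatrix.transpose.mulVecLin) ≤
      Nat.card D.GraphPiece := by
    have hle : LinearMap.ker D.arcMatrix.transpose.mulVecLin ≤ LinearMap.range
        (LinearMap.funLeft (ZMod 2) (ZMod 2)
          (fun x : Fin D.c => (Quot.mk _ (x, 0) : D.GraphPiece))) := by
      intro f hf
      refine ⟨Quot.lift (fun d => f d.1) ?_, ?_⟩
      · rintro d d' (rfl | hd)
        · have := congrFun (LinearMap.mem_ker.1 hf) (Quotient.mk D.arcSetoid d)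
          rw [Matrix.mulVecLin_apply, arcMatrix_transpose_mulVec] at this
          exact CharTwo.add_eq_zero.1 this
        · simp [hd]
      · ext x; rfl
    calc _ ≤ _ := Submodule.finrank_mono hle
      _ ≤ Module.finrank (ZMod 2) (D.GraphPiece → ZMod 2) := LinearMap.finrank_range_le _
      _ = _ := by rw [Module.finrank_fintype_fun_eq_card, Nat.card_eq_fintype_card]
  have hrank : D.arcMatrix.transpose.rank = D.arcMatrix.rank := Matrix.rank_transpose _
  have h1 := LinearMap.finrank_range_add_finrank_ker D.arcMatrix.transpose.mulVecLin
  have h2 := LinearMap.finrank_range_add_finrank_ker D.arcMatrix.mulVecLin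
  rw [Module.finrank_fintype_fun_eq_card] at h1 h2
  rw [Fintype.card_fin] at h1
  rw [← Nat.card_eq_fintype_card, card_arcs] at h2
  unfold Matrix.rank at hrank
  have h3 : Module.finrank (ZMod 2) D.cycleSpace ≤
      Module.finrank (ZMod 2) (LinearMap.ker D.arcMatrix.mulVecLin) := by
    have hle : D.cycleSpace ≤ (LinearMap.ker D.arcMatrix.mulVecLin).map
        (LinearMap.funLeft (ZMod 2) (ZMod 2) (Quotient.mk D.arcSetoid)) := by
      rintro a ⟨ha, ha'⟩
      refine ⟨Quotient.lift a ?_, ?_, ?_⟩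
      · rintro d d' (rfl | rfl)
        · rfl
        · exact (ha d).symm
      · ext x
        rw [Matrix.mulVecLin_apply, arcMatrix_mulVec]
        exact ha' x
      · ext d; rfl
    exact (Submodule.finrank_mono hle).trans (Submodule.finrank_map_le _ _)
  omega

/-- A mod 2 Jordan curve theorem.  The faces bound as large a space of cycles as there can be,
because Euler's formula makes the dimensions agree. -/
theorem exists_face_coloring (a : Dart D.c → ZMod 2) (harc : ∀ d, a (D.arc d) = a d)
    (hv : ∀ x, ∑ k, a (x, k) = 0) :
    ∃ h : Dart D.c → ZMod 2, (∀ d, h (D.arc d) = h (d.1, d.2 + 1)) ∧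
      ∀ d, h d + h (d.1, d.2 + 1) = a d := by
  have := Fintype.ofFinite D.Face
  have h1 := LinearMap.finrank_range_add_finrank_ker D.faceBoundary
  rw [Module.finrank_fintype_fun_eq_card, ← Nat.card_eq_fintype_card, D.planar] at h1
  have h2 := D.finrank_ker_faceBoundary_le
  have h3 := D.finrank_cycleSpace_le
  have h4 := Submodule.eq_of_le_of_finrank_le D.range_faceBoundary_le (by
    change _ + _ = D.c + 2 * Nat.card D.GraphPiece at h1
    omega)
  have h5 : a ∈ LinearMap.range D.faceBoundary := h4 ▸ ⟨harc, hv⟩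
  obtain ⟨h, rfl⟩ := h5
  exact ⟨fun d => h (Quot.mk _ d), fun d => congrArg h (D.face_mk_arc d), fun d => rfl⟩

end LinkDiagram

/-! ### Strands and crossings -/

namespace LinkDiagram

variable {D : LinkDiagram}

theorem smoothing_smoothing (l : Label) (k : Fin 4) : smoothing l (smoothing l k) = k := by
  cases l <;> fin_cases k <;> rfl

theorem smoothing_ne (l : Label) (k : Fin 4) : smoothing l k ≠ k := by
  cases l <;> fin_cases k <;> decide

/-- The half-edge that is joined to `d` by the smoothing of its crossing. -/
def turn (s : D.State) (d : Dart D.c) : Dart D.c := (d.1, smoothing (s d.1) d.2)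

theorem turn_turn (s : D.State) (d : Dart D.c) : turn s (turn s d) = d := by
  simp [turn, smoothing_smoothing]

theorem turn_ne (s : D.State) (d : Dart D.c) : turn s d ≠ d := fun h =>
  smoothing_ne _ _ (congrArg Prod.snd h)

/-- A face coloring does not change when one passes a smoothed crossing between two half-edges
neither of which separates two colors: the two half-edges have a face in common. -/
theorem coloring_turn {h : Dart D.c → ZMod 2} (s : D.State) (d : Dart D.c)
    (h₁ : h (d.1, d.2 + 1) = h d)
    (h₂ : h ((turn s d).1, (turn s d).2 + 1) = h (turn s d)) : h (turn s d) = h d := by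
  obtain ⟨y, k⟩ := d
  change h (y, k + 1) = h (y, k) at h₁
  change h (y, smoothing (s y) k + 1) = h (y, smoothing (s y) k) at h₂
  change h (y, smoothing (s y) k) = h (y, k)
  generalize s y = l at h₂ ⊢
  cases l <;> fin_cases k <;> first | exact h₁ | exact h₂.symm

/-- Two half-edges follow each other on `sD` with the crossing `x` cut open. -/
def OffStep (s : D.State) (x : Fin D.c) (d d' : Dart D.c) : Prop :=
  d' = D.arc d ∨ (d.1 ≠ x ∧ d' = turn s d)

/-- The half-edge `d` lies on the strand that leaves the crossing `x` along the half-edge `k`, when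
all the other crossings are smoothed according to `s`. -/
def Strand (s : D.State) (x : Fin D.c) (k : Fin 4) (d : Dart D.c) : Prop :=
  Relation.ReflTransGen (OffStep s x) (x, k) d

theorem OffStep.symm {s : D.State} {x : Fin D.c} {d d' : Dart D.c} (h : OffStep s x d d') :
    OffStep s x d' d := by
  rcases h with rfl | ⟨h, rfl⟩
  · exact Or.inl (D.arc_arc d).symm
  · exact Or.inr ⟨h, (turn_turn s d).symm⟩

theorem OffStep.reflTransGen_symm {s : D.State} {x : Fin D.c} {d d' : Dart D.c}
    (h : Relation.ReflTransGen (OffStep s x) d d') : Relation.ReflTransGen (OffStep s x) d' d := by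
  induction h with
  | refl => exact .refl
  | tail _ h ih => exact .head h.symm ih

namespace Strand

variable {s : D.State} {x : Fin D.c} {k j : Fin 4} {d d' : Dart D.c}

theorem symm (h : Strand s x k (x, j)) : Strand s x j (x, k) := OffStep.reflTransGen_symm h

theorem trans (h : Strand s x k (x, j)) (h' : Strand s x j d) : Strand s x k d :=
  Relation.ReflTransGen.trans h h'

theorem refl : Strand s x k (x, k) := Relation.ReflTransGen.refl

theorem of_common (h : Strand s x k d) (h' : Strand s x j d) : Strand s x k (x, j) :=
  Relation.ReflTransGen.trans h (OffStep.reflTransGen_symm h')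

theorem arc (h : Strand s x k d) : Strand s x k (D.arc d) := .tail h (Or.inl rfl)

theorem turn (h : Strand s x k d) (hd : d.1 ≠ x) : Strand s x k (turn s d) :=
  .tail h (Or.inr ⟨hd, rfl⟩)

theorem arc_iff : Strand s x k (D.arc d) ↔ Strand s x k d :=
  ⟨fun h => by simpa [D.arc_arc] using h.arc, arc⟩

theorem turn_iff (hd : d.1 ≠ x) : Strand s x k (LinkDiagram.turn s d) ↔ Strand s x k d :=
  ⟨fun h => by simpa [turn_turn] using h.turn hd, fun h => h.turn hd⟩

theorem congr {s' : D.State} (hoff : ∀ y, y ≠ x → s y = s' y) (h : Strand s x k d) :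
    Strand s' x k d := by
  induction h with
  | refl => exact refl
  | tail _ hstep ih =>
    rcases hstep with rfl | ⟨hd, rfl⟩
    · exact ih.arc
    · simpa [LinkDiagram.turn, hoff _ hd] using ih.turn hd

/-- A strand that leaves `x` comes back to `x`: the half-edges visited until the first return are
closed under all the steps. -/
theorem exists_end (s : D.State) (x : Fin D.c) (k : Fin 4) :
    ∃ e, Strand s x k (x, e) ∧ ∀ j, Strand s x k (x, j) → j = k ∨ j = e := by
  classical
  let g : Equiv.Perm (Dart D.c) :=
    (Function.Involutive.toPerm D.arc D.arc_arc).trans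
      (Function.Involutive.toPerm (LinkDiagram.turn s) (turn_turn s))
  have hg : ∀ d, g d = LinkDiagram.turn s (D.arc d) := fun d => rfl
  have hgs : ∀ i d, (g ^ (i + 1)) d = LinkDiagram.turn s (D.arc ((g ^ i) d)) := by
    intro i d
    rw [pow_succ', Equiv.Perm.mul_apply, hg]
  -- the circle through `(x, k)` closes up, so its last arc ends at `x`
  have hex : ∃ i, (D.arc ((g ^ i) (x, k))).1 = x := by
    refine ⟨orderOf g - 1, ?_⟩
    have h1 : (g ^ (orderOf g - 1 + 1)) (x, k) = (x, k) := by
      rw [Nat.sub_add_cancel (orderOf_pos g), pow_orderOf_eq_one]; rfl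
    rw [hgs] at h1
    exact congrArg Prod.fst h1
  set n := Nat.find hex with hn
  have hnx : (D.arc ((g ^ n) (x, k))).1 = x := Nat.find_spec hex
  have hlt : ∀ i < n, (D.arc ((g ^ i) (x, k))).1 ≠ x := fun i hi => Nat.find_min hex hi
  have hreach : ∀ i ≤ n, Strand s x k ((g ^ i) (x, k)) := by
    intro i
    induction i with
    | zero => intro _; exact .refl
    | succ i ih =>
      intro hi
      rw [hgs]
      exact (ih (by omega)).arc.turn (hlt i (by omega))
  have hsub : ∀ d, Strand s x k d →
      ∃ i ≤ n, d = (g ^ i) (x, k) ∨ d = D.arc ((g ^ i) (x, k)) := by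
    intro d hd
    induction hd with
    | refl => exact ⟨0, Nat.zero_le _, Or.inl rfl⟩
    | tail _ hstep ih =>
      obtain ⟨i, hi, hd⟩ := ih
      rcases hstep with rfl | ⟨hx, rfl⟩
      · rcases hd with rfl | rfl
        · exact ⟨i, hi, Or.inr rfl⟩
        · exact ⟨i, hi, Or.inl (D.arc_arc _)⟩
      · rcases hd with rfl | rfl
        · cases i with
          | zero => exact absurd rfl hx
          | succ i =>
            exact ⟨i, by omega, Or.inr (by rw [hgs, turn_turn])⟩
        · have : i ≠ n := by rintro rfl; exact hx hnx
          exact ⟨i + 1, by omega, Or.inl (hgs i _).symm⟩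
  refine ⟨(D.arc ((g ^ n) (x, k))).2, ?_, ?_⟩
  · have := (hreach n le_rfl).arc
    rwa [← Prod.mk.eta (p := D.arc ((g ^ n) (x, k))), hnx] at this
  · intro j hj
    obtain ⟨i, hi, hd | hd⟩ := hsub _ hj
    · cases i with
      | zero => exact Or.inl (congrArg Prod.snd hd)
      | succ i =>
        rw [hgs] at hd
        exact absurd (congrArg Prod.fst hd).symm (hlt i (by omega))
    · have : i = n := by
        by_contra hne
        exact hlt i (by omega) (congrArg Prod.fst hd).symm
      subst this
      exact Or.inr (congrArg Prod.snd hd)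

/-- Two fixed point free involutions, the arcs on all the half-edges of a strand and the smoothings
on those outside `x`, show that a strand contains an even number of half-edges at `x`. -/
theorem sum_end_eq_zero [∀ d, Decidable (Strand s x k d)] :
    ∑ j, (if Strand s x k (x, j) then 1 else 0 : ZMod 2) = 0 := by
  classical
  let a : Dart D.c → ZMod 2 := fun d => if Strand s x k d then 1 else 0
  have h2 : ∀ t : ZMod 2, t + t = 0 := CharTwo.add_self_eq_zero
  have h1 : ∑ d, a d = 0 := by
    refine Finset.sum_involution (fun d _ => D.arc d) ?_ (fun d _ _ => D.arc_ne d) (by simp)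
      (fun d _ => D.arc_arc d)
    intro d _
    simp only [a, arc_iff, h2]
  have h3 : ∑ d ∈ Finset.univ.filter (fun d : Dart D.c => d.1 ≠ x), a d = 0 := by
    refine Finset.sum_involution (fun d _ => LinkDiagram.turn s d) ?_
      (fun d _ _ => turn_ne s d) ?_ (fun d _ => turn_turn s d)
    · intro d hd
      simp only [a, turn_iff (Finset.mem_filter.1 hd).2, h2]
    · intro d hd
      exact Finset.mem_filter.2 ⟨Finset.mem_univ _, (Finset.mem_filter.1 hd).2⟩
  rw [← Finset.sum_filter_add_sum_filter_not _ (fun d : Dart D.c => d.1 ≠ x), h3, zero_add] at h1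
  refine Eq.trans ?_ h1
  simp only [ne_eq, not_not]
  rw [Finset.sum_filter, Fintype.sum_prod_type, Finset.sum_eq_single x]
  · simp only [if_true, a]
  · intro y _ hy
    simp [hy]
  · simp

/-- The two ends of a strand are different. -/
theorem exists_other_end (s : D.State) (x : Fin D.c) (k : Fin 4) :
    ∃ e, e ≠ k ∧ ∀ j, Strand s x k (x, j) ↔ j = k ∨ j = e := by
  classical
  obtain ⟨e, he, h⟩ := exists_end s x k
  have hiff : ∀ j, Strand s x k (x, j) ↔ j = k ∨ j = e := fun j => ⟨h j, by
    rintro (rfl | rfl)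
    · exact refl
    · exact he⟩
  refine ⟨e, ?_, hiff⟩
  rintro rfl
  have := sum_end_eq_zero (s := s) (x := x) (k := e)
  simp [hiff] at this

theorem circle_eq {s' : D.State} (hoff : ∀ y, y ≠ x → s y = s' y) (h : Strand s x k d) :
    circleOf s' (x, k) = circleOf s' d := by
  induction h with
  | refl => rfl
  | tail _ hstep ih =>
    rw [ih]
    rcases hstep with rfl | ⟨hd, rfl⟩
    · exact congrArg Sum.inl (Quot.sound (Or.inl rfl))
    · exact congrArg Sum.inl (Quot.sound (Or.inr (by simp [LinkDiagram.turn, hoff _ hd])))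

/-- By planarity, a strand does not connect opposite half-edges at `x`: it would be crossed exactly
once, at `x`, by the strand between the other two half-edges. -/
theorem not_opposite (s : D.State) (x : Fin D.c) : ¬ Strand s x 0 (x, 2) := by
  classical
  intro h02
  obtain ⟨e, he, hiff⟩ := exists_other_end s x 0
  obtain rfl : e = 2 := by
    rcases (hiff 2).1 h02 with h | h
    · exact absurd h (by decide)
    · exact h.symm
  have h01 : ¬ Strand s x 0 (x, 1) := by rw [hiff]; decide
  have h13 : Strand s x 1 (x, 3) := by
    obtain ⟨e, he, hiff1⟩ := exists_other_end s x 1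
    have h0 : ¬ Strand s x 1 (x, 0) := fun h => h01 h.symm
    have h2 : ¬ Strand s x 1 (x, 2) := fun h => h01 (h02.trans h.symm)
    rw [hiff1] at h0 h2 ⊢
    clear hiff1
    revert e; decide
  obtain ⟨h, hh, hha⟩ := D.exists_face_coloring (fun d => if Strand s x 0 d then 1 else 0)
    (fun d => by simp only [arc_iff]) (by
      intro y
      by_cases hy : y = x
      · subst hy
        simp only [hiff]
        decide
      · have ht : ∀ k, Strand s x 0 (y, smoothing (s y) k) ↔ Strand s x 0 (y, k) := fun k =>
          turn_iff (s := s) (x := x) (k := 0) (d := (y, k)) hy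
        have h2 : ∀ t : ZMod 2, t + t = 0 := CharTwo.add_self_eq_zero
        have t0 := ht 0
        have t2 := ht 2
        rw [Fin.sum_univ_four]
        cases hl : s y with
        | A =>
          rw [hl] at t0 t2
          have e0 : smoothing Label.A 0 = 1 := rfl
          have e2 : smoothing Label.A 2 = 3 := rfl
          rw [e0] at t0
          rw [e2] at t2
          simp only [t0, t2]
          rw [h2, zero_add, h2]
        | B =>
          rw [hl] at t0 t2
          have e0 : smoothing Label.B 0 = 3 := rfl
          have e2 : smoothing Label.B 2 = 1 := rfl
          rw [e0] at t0
          rw [e2] at t2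
          simp only [t0, t2]
          linear_combination h2 (if Strand s x 0 (y, 0) then 1 else 0) +
            h2 (if Strand s x 0 (y, 2) then 1 else 0))
  -- the other strand is disjoint from the first, so both of its sides keep one color
  have hoff : ∀ d, Strand s x 1 d → h (d.1, d.2 + 1) = h d := by
    intro d hd
    have h0 : ¬ Strand s x 0 d := fun h' => h01 (h'.of_common hd)
    have := hha d
    rw [if_neg h0] at this
    exact (CharTwo.add_eq_zero.1 this).symm
  have key : ∀ d, Strand s x 1 d → h d = h (x, 1) := by
    intro d hd
    induction hd with
    | refl => rfl
    | @tail d d' hd hstep ih =>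
      have hd' : Strand s x 1 d' := .tail hd hstep
      have a1 := hoff d hd
      have a2 := hoff d' hd'
      rw [← ih]
      rcases hstep with rfl | ⟨_, rfl⟩
      · rw [hh, a1]
      · exact coloring_turn s d a1 a2
  have h3 := key _ h13
  have h2 : h (x, 2) = h (x, 1) := hoff _ refl
  have := hha (x, 2)
  rw [if_pos h02] at this
  have e3 : ((x, 2).1, (x, 2).2 + 1) = ((x, 3) : Dart D.c) := rfl
  rw [e3, h2, h3, CharTwo.add_self_eq_zero] at this
  exact zero_ne_one this

end Strand

end LinkDiagram

/-! ### Joining and splitting circles -/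

namespace LinkDiagram

variable {D : LinkDiagram}

theorem circleOf_arc (s : D.State) (d : Dart D.c) : circleOf s (D.arc d) = circleOf s d :=
  (congrArg Sum.inl (Quot.sound (r := CircleStep s) (Or.inl rfl))).symm

theorem circleOf_turn (s : D.State) (d : Dart D.c) : circleOf s (turn s d) = circleOf s d :=
  (congrArg Sum.inl (Quot.sound (r := CircleStep s) (Or.inr rfl))).symm

theorem circleOf_smoothing (s : D.State) (x : Fin D.c) (k : Fin 4) :
    circleOf s (x, smoothing (s x) k) = circleOf s (x, k) := circleOf_turn s (x, k)

/-- A function on half-edges that does not change along the steps of `sD` is constant on circles. -/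
theorem eq_of_circleOf_eq {α : Type*} {s : D.State} (f : Dart D.c → α)
    (harc : ∀ d, f (D.arc d) = f d) (hturn : ∀ d, f (turn s d) = f d) {d d' : Dart D.c}
    (h : circleOf s d = circleOf s d') : f d = f d' := by
  have h' : (Quot.mk (CircleStep s) d) = Quot.mk _ d' := Sum.inl_injective h
  refine congrArg (Quot.lift f ?_) h'
  rintro d d' (rfl | rfl)
  · exact (harc d).symm
  · exact (hturn d).symm

/-- The state `s'` arises from `s` by joining the circles through `d₀` and `d₁`. -/
structure Merge (s s' : D.State) (d₀ d₁ : Dart D.c) : Prop where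
  ne : circleOf s d₀ ≠ circleOf s d₁
  card_eq : Nat.card (Circle s) = Nat.card (Circle s') + 1
  eq_iff : ∀ d d', circleOf s' d = circleOf s' d' ↔ circleOf s d = circleOf s d' ∨
    ((circleOf s d = circleOf s d₀ ∨ circleOf s d = circleOf s d₁) ∧
      (circleOf s d' = circleOf s d₀ ∨ circleOf s d' = circleOf s d₁))

/-- If the strand at `x` closes up in `s`, then the two half-edges joined by `s` at `x` are also
connected away from `x`, and changing the label of `x` joins two different circles. -/
theorem merge_of_strand {s s' : D.State} {x : Fin D.c} (hoff : ∀ y, y ≠ x → s y = s' y)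
    (hx : s x ≠ s' x) (hst : Strand s x 0 (x, smoothing (s x) 0)) :
    Merge s s' (x, 0) (x, smoothing (s' x) 0) := by
  classical
  set p := smoothing (s x) with hp
  set b := smoothing (s' x) 0 with hb
  -- the four half-edges at `x`
  have hfour : b ≠ 0 ∧ b ≠ p 0 ∧ ∀ j, j = 0 ∨ j = p 0 ∨ j = b ∨ j = p b := by
    rw [hp, hb]
    revert hx
    cases s x <;> cases s' x <;> decide
  obtain ⟨hb0, hbp, hall⟩ := hfour
  obtain ⟨e, he, hiff⟩ := Strand.exists_other_end s x 0
  obtain rfl : p 0 = e := ((hiff _).1 hst).resolve_left (smoothing_ne _ _)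
  have hnb : ¬ Strand s x 0 (x, b) := by
    rw [hiff]; tauto
  have hst' : Strand s x b (x, p b) := by
    obtain ⟨e, heb, hiffb⟩ := Strand.exists_other_end s x b
    have h1 : Strand s x b (x, e) := (hiffb e).2 (Or.inr rfl)
    have h2 : ¬ Strand s x 0 (x, e) := fun h => hnb (h.of_common h1)
    rw [hiff] at h2
    rcases hall e with h | h | h | h
    · tauto
    · tauto
    · tauto
    · exact h ▸ h1
  have hpp : ∀ j, p (p j) = j := smoothing_smoothing (s x)
  have hmem : ∀ d, circleOf s (x, 0) = circleOf s d → Strand s x 0 d := by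
    intro d hd
    have := eq_of_circleOf_eq (s := s) (fun d => Strand s x 0 d)
      (fun d => propext Strand.arc_iff) (fun d => propext ?_) hd
    · exact this ▸ Strand.refl
    · by_cases hdx : d.1 = x
      · obtain ⟨y, j⟩ := d
        obtain rfl : y = x := hdx
        change Strand s y 0 (y, p j) ↔ _
        rw [hiff, hiff]
        constructor
        · rintro (h | h)
          · right; rw [← h, hpp]
          · left; rw [← hpp j, h, hpp]
        · rintro (h | h)
          · right; rw [h]
          · left; rw [h, hpp]
      · exact Strand.turn_iff hdx
  have hne : circleOf s (x, 0) ≠ circleOf s (x, b) := fun h => hnb (hmem _ h)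
  have hxp : ∀ j, circleOf s' (x, p j) = circleOf s' (x, j) := by
    intro j
    have e1 := hst.circle_eq hoff
    have e2 := hst'.circle_eq hoff
    rcases hall j with rfl | rfl | rfl | rfl
    · exact e1.symm
    · rw [hpp]; exact e1
    · exact e2.symm
    · rw [hpp]; exact e2
  have hturn' : ∀ d, circleOf s' (turn s d) = circleOf s' d := by
    intro d
    by_cases hdx : d.1 = x
    · obtain ⟨y, j⟩ := d
      obtain rfl : y = x := hdx
      exact hxp j
    · have : turn s d = turn s' d := by simp [turn, hoff _ hdx]
      rw [this, circleOf_turn]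
  have hb' : circleOf s' (x, b) = circleOf s' (x, 0) := circleOf_smoothing s' x 0
  -- `θ` is the quotient map, and `ψ` below identifies the circles of `s'` with all the circles of
  -- `s` but the one through `b`
  let θ : Circle s → Circle s' := Sum.map (Quot.lift (fun d => Quot.mk _ d) (by
    rintro d d' (rfl | rfl)
    · exact Sum.inl_injective (circleOf_arc s' d).symm
    · exact Sum.inl_injective (hturn' d).symm)) id
  have hθ : ∀ d, θ (circleOf s d) = circleOf s' d := fun d => rfl
  let φ : Circle s → Circle s := fun q => if q = circleOf s (x, b) then circleOf s (x, 0) else q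
  have hθφ : ∀ q, θ (φ q) = θ q := by
    intro q
    by_cases hq : q = circleOf s (x, b)
    · simp only [φ, hq, if_true, hθ, hb']
    · simp only [φ, if_neg hq]
  have hφall : ∀ j, φ (circleOf s (x, j)) = circleOf s (x, 0) := by
    intro j
    have : circleOf s (x, j) = circleOf s (x, 0) ∨ circleOf s (x, j) = circleOf s (x, b) := by
      rcases hall j with rfl | rfl | rfl | rfl
      · exact Or.inl rfl
      · exact Or.inl (circleOf_smoothing s x 0)
      · exact Or.inr rfl
      · exact Or.inr (circleOf_smoothing s x b)
    rcases this with h | h <;> simp only [φ, h, if_neg hne, if_true]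
  have hφ : ∀ d d', circleOf s' d = circleOf s' d' →
      φ (circleOf s d) = φ (circleOf s d') := by
    intro d d' h
    refine eq_of_circleOf_eq (fun d => φ (circleOf s d)) (fun d => by rw [circleOf_arc])
      (fun d => ?_) h
    by_cases hdx : d.1 = x
    · obtain ⟨y, j⟩ := d
      obtain rfl : y = x := hdx
      exact (hφall _).trans (hφall _).symm
    · have : turn s' d = turn s d := by simp [turn, hoff _ hdx]
      rw [this, circleOf_turn]
  refine ⟨hne, ?_, ?_⟩
  · let ψ : Circle s' → {q : Circle s // q ≠ circleOf s (x, b)} := fun q =>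
      ⟨Sum.elim (Quot.lift (fun d => φ (circleOf s d)) (fun d d' h =>
        hφ d d' (congrArg Sum.inl (Quot.sound h)))) Sum.inr q, by
        rcases q with q | q
        · induction q using Quot.ind with
          | mk d =>
            simp only [Sum.elim_inl, φ]
            split_ifs with h
            · exact hne
            · exact h
        · simp [circleOf]⟩
    have hbij : Function.Bijective ψ := by
      constructor
      · have hinv : ∀ q, θ (ψ q).1 = q := by
          rintro (q | q)
          · induction q using Quot.ind with
            | mk d => exact hθφ _
          · rfl
        exact fun q q' h => by rw [← hinv q, h, hinv]
      · rintro ⟨q | q, hq⟩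
        · induction q using Quot.ind with
          | mk d => exact ⟨circleOf s' d, Subtype.ext (if_neg hq)⟩
        · exact ⟨Sum.inr q, rfl⟩
    rw [Nat.card_congr (Equiv.ofBijective ψ hbij), ← Finite.card_option,
      Nat.card_congr (Equiv.optionSubtypeNe (circleOf s (x, b)))]
  · intro d d'
    have : circleOf s' d = circleOf s' d' ↔ φ (circleOf s d) = φ (circleOf s d') :=
      ⟨hφ d d', fun h => by rw [← hθ, ← hθ, ← hθφ, h, hθφ]⟩
    rw [this]
    simp only [φ]
    by_cases h1 : circleOf s d = circleOf s (x, b) <;>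
      by_cases h2 : circleOf s d' = circleOf s (x, b) <;> simp [h1, h2]
    · constructor
      · intro h; exact Or.inr h.symm
      · rintro (h | h)
        · exact absurd h.symm h2
        · exact h.symm
    · intro h h'
      exact h.trans h'.symm

/-- By planarity, changing the label of a crossing from `A` to `B` either joins two circles or
splits a circle. -/
theorem merge_or_merge (s : D.State) (x : Fin D.c) (hx : s x = Label.A) :
    Merge s (Function.update s x Label.B) (x, 0) (x, 2) ∨
      Merge (Function.update s x Label.B) s (x, 0) (x, 1) := by
  set s' := Function.update s x Label.B with hs'
  have hx' : s' x = Label.B := by simp [hs']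
  have hoff : ∀ y, y ≠ x → s y = s' y := fun y hy => by simp [hs', hy]
  obtain ⟨e, he, hiff⟩ := Strand.exists_other_end s x 0
  have hne2 : e ≠ 2 := by
    rintro rfl
    exact Strand.not_opposite s x ((hiff 2).2 (Or.inr rfl))
  have hst := (hiff e).2 (Or.inr rfl)
  -- the strand from the half-edge `0` closes up in `s` if it ends at `1`, and in `s'` if it ends
  -- at `3`
  obtain rfl | rfl : e = 1 ∨ e = 3 := by
    clear hiff hst; revert e; decide
  · left
    have := merge_of_strand hoff (by simp [hx, hx']) (by rw [hx]; exact hst)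
    have h32 : circleOf s (x, smoothing (s' x) 0) = circleOf s (x, 2) := by
      have := circleOf_smoothing s x 2
      rw [hx] at this
      rw [hx']
      exact this
    refine ⟨h32 ▸ this.ne, this.card_eq, ?_⟩
    have h3 := this.eq_iff
    rwa [h32] at h3
  · right
    have := merge_of_strand (s := s') (s' := s) (x := x) (fun y hy => (hoff y hy).symm)
      (by simp [hx, hx']) (by rw [hx']; exact hst.congr hoff)
    rw [hx] at this
    exact this

/-- The faces can be colored so that exactly the circles of `sD` with the property `P` separate the
two colors. -/
theorem exists_circle_coloring (s : D.State) (P : Circle s → Prop) [DecidablePred P] :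
    ∃ h : Dart D.c → ZMod 2, (∀ d, h (D.arc d) = h (d.1, d.2 + 1)) ∧
      ∀ d, h d + h (d.1, d.2 + 1) = if P (circleOf s d) then 1 else 0 := by
  refine D.exists_face_coloring _ (fun d => by simp only [circleOf_arc]) (fun y => ?_)
  have h2 : ∀ t : ZMod 2, t + t = 0 := CharTwo.add_self_eq_zero
  have t0 := circleOf_smoothing s y 0
  have t2 := circleOf_smoothing s y 2
  rw [Fin.sum_univ_four]
  cases hl : s y with
  | A =>
    rw [hl] at t0 t2
    change circleOf s (y, 1) = _ at t0
    change circleOf s (y, 3) = _ at t2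
    rw [t0, t2]
    linear_combination h2 (if P (circleOf s (y, 0)) then 1 else 0) +
      h2 (if P (circleOf s (y, 2)) then 1 else 0)
  | B =>
    rw [hl] at t0 t2
    change circleOf s (y, 3) = _ at t0
    change circleOf s (y, 1) = _ at t2
    rw [t0, t2]
    linear_combination h2 (if P (circleOf s (y, 0)) then 1 else 0) +
      h2 (if P (circleOf s (y, 2)) then 1 else 0)

end LinkDiagram

/-! ### The number of circles of a state -/

namespace LinkDiagram

variable {D : LinkDiagram}

/-- A face coloring is constant along a circle neither of whose arcs separates two colors. -/
theorem coloring_eq_of_circleOf_eq {s : D.State} {h : Dart D.c → ZMod 2}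
    (hh : ∀ d, h (D.arc d) = h (d.1, d.2 + 1)) {d₀ d : Dart D.c}
    (hz : ∀ d, circleOf s d = circleOf s d₀ → h (d.1, d.2 + 1) = h d)
    (hd : circleOf s d = circleOf s d₀) : h d = h d₀ := by
  have key : (circleOf s d₀ = circleOf s d₀ ∧ h d₀ = h d₀) =
      (circleOf s d = circleOf s d₀ ∧ h d = h d₀) := by
    refine eq_of_circleOf_eq (s := s) (fun d => circleOf s d = circleOf s d₀ ∧ h d = h d₀)
      (fun d => ?_) (fun d => ?_) hd.symm
    · rw [circleOf_arc]
      refine propext (and_congr_right fun hc => ?_)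
      rw [hh, hz d hc]
    · rw [circleOf_turn]
      refine propext (and_congr_right fun hc => ?_)
      rw [coloring_turn s d (hz d hc) (hz _ (by rw [circleOf_turn, hc]))]
  exact (key.mp ⟨rfl, rfl⟩).2

/-- The state whose set of `B`-labelled crossings is `S`. -/
def stateOf (D : LinkDiagram) (S : Finset (Fin D.c)) : D.State :=
  fun x => if x ∈ S then Label.B else Label.A

theorem stateOf_empty : D.stateOf ∅ = D.stateA := by
  funext x; simp [stateOf, stateA]

theorem stateOf_insert (S : Finset (Fin D.c)) (x : Fin D.c) :
    D.stateOf (insert x S) = Function.update (D.stateOf S) x Label.B := by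
  funext y
  by_cases h : y = x
  · subst h; simp [stateOf]
  · simp [stateOf, h]

theorem circleOf_of_notMem {S : Finset (Fin D.c)} {x : Fin D.c} (hx : x ∉ S) :
    circleOf (D.stateOf S) (x, 1) = circleOf (D.stateOf S) (x, 0) ∧
      circleOf (D.stateOf S) (x, 3) = circleOf (D.stateOf S) (x, 2) := by
  have h : D.stateOf S x = Label.A := if_neg hx
  have h0 := circleOf_smoothing (D.stateOf S) x 0
  have h2 := circleOf_smoothing (D.stateOf S) x 2
  rw [h] at h0 h2
  exact ⟨h0, h2⟩

theorem circleOf_of_mem {S : Finset (Fin D.c)} {x : Fin D.c} (hx : x ∈ S) :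
    circleOf (D.stateOf S) (x, 3) = circleOf (D.stateOf S) (x, 0) ∧
      circleOf (D.stateOf S) (x, 2) = circleOf (D.stateOf S) (x, 1) := by
  have h : D.stateOf S x = Label.B := if_pos hx
  have h0 := circleOf_smoothing (D.stateOf S) x 0
  have h2 := circleOf_smoothing (D.stateOf S) x 1
  rw [h] at h0 h2
  exact ⟨h0, h2⟩

theorem circleOf_stateA (x : Fin D.c) :
    circleOf D.stateA (x, 1) = circleOf D.stateA (x, 0) ∧
      circleOf D.stateA (x, 3) = circleOf D.stateA (x, 2) := by
  rw [← stateOf_empty]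
  exact circleOf_of_notMem (by simp)

/-- The ends of the chord of `s_A D` at a crossing. -/
def chord (x : Fin D.c) : Sym2 (Circle D.stateA) :=
  s(circleOf D.stateA (x, 0), circleOf D.stateA (x, 2))

/-- The annulus between two circles `u` and `v` of `s_A D` that are connected by a chord `y`, as a
set of faces.  All the chords between `u` and `v` run inside of it. -/
theorem exists_annulus {y : Fin D.c} (hy : circleOf D.stateA (y, 0) ≠ circleOf D.stateA (y, 2)) :
    ∃ m : Dart D.c → ZMod 2, (∀ d, m (D.arc d) = m (d.1, d.2 + 1)) ∧
      (∀ d d', circleOf D.stateA d = circleOf D.stateA d' →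
        m d + m (d.1, d.2 + 1) = m d' + m (d'.1, d'.2 + 1)) ∧
      ∀ z, chord z = chord y → m (z, 0) = 1 ∧ m (z, 1) = 0 ∧ m (z, 2) = 1 ∧ m (z, 3) = 0 := by
  classical
  set u := circleOf D.stateA (y, 0) with hu
  set v := circleOf D.stateA (y, 2) with hv
  obtain ⟨f, hf, hf'⟩ := exists_circle_coloring D.stateA (· = u)
  obtain ⟨g, hg, hg'⟩ := exists_circle_coloring D.stateA (· = v)
  have hfv : ∀ d, circleOf D.stateA d = v → f d = f (y, 2) := fun d hd =>
    coloring_eq_of_circleOf_eq hf (fun d' hd' => by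
      have := hf' d'
      rw [if_neg (by rw [hd', ← hv]; exact hy.symm)] at this
      exact (CharTwo.add_eq_zero.1 this).symm) hd
  have hgu : ∀ d, circleOf D.stateA d = u → g d = g (y, 0) := fun d hd =>
    coloring_eq_of_circleOf_eq hg (fun d' hd' => by
      have := hg' d'
      rw [if_neg (by rw [hd', ← hu]; exact hy)] at this
      exact (CharTwo.add_eq_zero.1 this).symm) hd
  -- `f` is normalized to vanish along `v`, and `g` to vanish along `u`; the faces where both vanish
  -- form the annulus
  refine ⟨fun d => f d + f (y, 2) + g d + g (y, 0) + 1, fun d => by simp only [hf, hg], ?_, ?_⟩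
  · intro d d' hd
    have e1 := hf' d
    have e2 := hg' d
    have e3 := hf' d'
    have e4 := hg' d'
    rw [hd] at e1 e2
    linear_combination e1 + e2 - e3 - e4
  · intro z hz
    have e1 := (circleOf_stateA z).1
    have e3 := (circleOf_stateA z).2
    have f0 := hf' (z, 0)
    have f2 := hf' (z, 2)
    have g0 := hg' (z, 0)
    have g2 := hg' (z, 2)
    have f1 := hf' (z, 1)
    have g1 := hg' (z, 1)
    have f3 := hf' (z, 3)
    have g3 := hg' (z, 3)
    change f (z, 0) + f (z, 1) = _ at f0
    change f (z, 2) + f (z, 3) = _ at f2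
    change g (z, 0) + g (z, 1) = _ at g0
    change g (z, 2) + g (z, 3) = _ at g2
    change f (z, 1) + f (z, 2) = _ at f1
    change g (z, 1) + g (z, 2) = _ at g1
    change f (z, 3) + f (z, 0) = _ at f3
    change g (z, 3) + g (z, 0) = _ at g3
    have eq0 : ∀ {a b : ZMod 2}, a + b = 0 → b = a := by decide
    have eq1 : ∀ {a b : ZMod 2}, a + b = 1 → b = a + 1 := by decide
    have dec : ∀ a b : ZMod 2, a + a + b + b + 1 = 1 ∧ a + 1 + a + b + b + 1 = 0 ∧
        a + a + (b + 1) + b + 1 = 0 := by decide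
    simp only
    rcases Sym2.eq_iff.1 hz with ⟨h0, hh2⟩ | ⟨h0, hh2⟩
    · rw [← hu] at h0
      rw [← hv] at hh2
      rw [h0] at f0 g0 e1
      rw [hh2] at f2 g2 e3
      rw [e3] at f3
      rw [e1] at g1
      rw [if_pos rfl] at f0 g2
      rw [if_neg hy] at g0 g1
      rw [if_neg hy.symm] at f2 f3
      rw [eq1 f0, eq0 f3, eq0 f2, hfv _ hh2, eq1 g2, eq0 g1, eq0 g0, hgu _ h0]
      exact ⟨(dec _ _).1, (dec _ _).2.1, (dec _ _).1, (dec _ _).2.2⟩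
    · rw [← hv] at h0
      rw [← hu] at hh2
      rw [h0] at f0 g0 e1
      rw [hh2] at f2 g2 e3
      rw [e3] at g3
      rw [e1] at f1
      rw [if_pos rfl] at g0 f2
      rw [if_neg hy] at g2 g3
      rw [if_neg hy.symm] at f0 f1
      rw [eq1 f2, eq0 f1, eq0 f0, hfv _ h0, eq1 g0, eq0 g3, eq0 g2, hgu _ hh2]
      exact ⟨(dec _ _).1, (dec _ _).2.2, (dec _ _).1, (dec _ _).2.1⟩

/-- Two chords between the same circles of `s_A D` do not interlace in a circle of a state whose
`B`-labelled crossings are chords of that kind.  The function `val` in the proof is the color of the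
face next to a half-edge, taken inside of the annulus; it is constant along the circles of the
state. -/
theorem not_interlaced (hA : ∀ x : Fin D.c,
      circleOf D.stateA (x, 0) ≠ circleOf D.stateA (x, 2))
    {S : Finset (Fin D.c)} {x y : Fin D.c} (hS : ∀ z ∈ S, chord z = chord y) (hxS : x ∉ S)
    (hxy : chord x = chord y)
    (hne : circleOf (D.stateOf S) (y, 0) ≠ circleOf (D.stateOf S) (y, 1)) :
    ¬ ((circleOf (D.stateOf S) (x, 0) = circleOf (D.stateOf S) (y, 0) ∧
          circleOf (D.stateOf S) (x, 2) = circleOf (D.stateOf S) (y, 1)) ∨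
       (circleOf (D.stateOf S) (x, 0) = circleOf (D.stateOf S) (y, 1) ∧
          circleOf (D.stateOf S) (x, 2) = circleOf (D.stateOf S) (y, 0))) := by
  classical
  obtain ⟨m, hm, hmA, hmz⟩ := exists_annulus (hA y)
  obtain ⟨h, hh, hj⟩ := exists_circle_coloring (D.stateOf S)
    (· = circleOf (D.stateOf S) (y, 0))
  let val : Dart D.c → ZMod 2 := fun d =>
    m d * h d + m (d.1, d.2 + 1) * h (d.1, d.2 + 1)
  have eq2 : ∀ {a b c : ZMod 2}, a + b = b + c → a = c := by decide
  have hj' : ∀ d d', circleOf (D.stateOf S) d = circleOf (D.stateOf S) d' →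
      h d + h (d.1, d.2 + 1) = h d' + h (d'.1, d'.2 + 1) := fun d d' e => by
    rw [hj, hj, e]
  have hval : ∀ d d', circleOf (D.stateOf S) d = circleOf (D.stateOf S) d' → val d = val d' := by
    intro d d' hd
    refine eq_of_circleOf_eq val (fun d => ?_) (fun d => ?_) hd
    · have a1 := hh (D.arc d)
      have a2 := hm (D.arc d)
      rw [D.arc_arc] at a1 a2
      simp only [val]
      rw [← a1, ← a2, hm, hh, add_comm]
    · -- the two half-edges share one face, and the products agree on the two other faces
      obtain ⟨z, k⟩ := d
      by_cases hz : z ∈ S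
      · obtain ⟨m0, m1, m2, m3⟩ := hmz z (hS z hz)
        have c2 := (circleOf_of_mem hz).2
        have j2 : h (z, 1) + h (z, 2) = h (z, 2) + h (z, 3) := (hj' _ _ c2).symm
        have j3 := eq2 j2
        have hl : turn (D.stateOf S) (z, k) = (z, smoothing Label.B k) := by
          simp [turn, stateOf, hz]
        rw [hl]
        fin_cases k
        · change m (z, 3) * h (z, 3) + m (z, 0) * h (z, 0) =
            m (z, 0) * h (z, 0) + m (z, 1) * h (z, 1)
          rw [m1, m3]; ring
        · change m (z, 2) * h (z, 2) + m (z, 3) * h (z, 3) =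
            m (z, 1) * h (z, 1) + m (z, 2) * h (z, 2)
          rw [m1, m3]; ring
        · change m (z, 1) * h (z, 1) + m (z, 2) * h (z, 2) =
            m (z, 2) * h (z, 2) + m (z, 3) * h (z, 3)
          rw [m1, m3]; ring
        · change m (z, 0) * h (z, 0) + m (z, 1) * h (z, 1) =
            m (z, 3) * h (z, 3) + m (z, 0) * h (z, 0)
          rw [m1, m3]; ring
      · have j0 : h (z, 0) = h (z, 2) := eq2 (hj' _ _ (circleOf_of_notMem hz).1).symm
        have m0 : m (z, 0) = m (z, 2) := eq2 (hmA _ _ (circleOf_stateA z).1).symm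
        have hl : turn (D.stateOf S) (z, k) = (z, smoothing Label.A k) := by
          simp [turn, stateOf, hz]
        rw [hl]
        fin_cases k
        · change m (z, 1) * h (z, 1) + m (z, 2) * h (z, 2) =
            m (z, 0) * h (z, 0) + m (z, 1) * h (z, 1)
          rw [j0, m0]; ring
        · change m (z, 0) * h (z, 0) + m (z, 1) * h (z, 1) =
            m (z, 1) * h (z, 1) + m (z, 2) * h (z, 2)
          rw [j0, m0]; ring
        · change m (z, 3) * h (z, 3) + m (z, 0) * h (z, 0) =
            m (z, 2) * h (z, 2) + m (z, 3) * h (z, 3)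
          rw [j0, m0]; ring
        · change m (z, 2) * h (z, 2) + m (z, 3) * h (z, 3) =
            m (z, 3) * h (z, 3) + m (z, 0) * h (z, 0)
          rw [j0, m0]; ring
  have vx : val (x, 0) = val (x, 2) := by
    obtain ⟨m0, m1, m2, m3⟩ := hmz x hxy
    have j0 : h (x, 0) = h (x, 2) := eq2 (hj' _ _ (circleOf_of_notMem hxS).1).symm
    change m (x, 0) * h (x, 0) + m (x, 1) * h (x, 1) = m (x, 2) * h (x, 2) + m (x, 3) * h (x, 3)
    rw [m0, m1, m2, m3, j0]; ring
  have vy : val (y, 0) ≠ val (y, 1) := by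
    obtain ⟨m0, m1, m2, m3⟩ := hmz y rfl
    have j0 : h (y, 0) + h (y, 1) = 1 := (hj (y, 0)).trans (if_pos rfl)
    have j1 : h (y, 1) + h (y, 2) = 0 := (hj (y, 1)).trans (if_neg hne.symm)
    change m (y, 0) * h (y, 0) + m (y, 1) * h (y, 1) ≠ m (y, 1) * h (y, 1) + m (y, 2) * h (y, 2)
    rw [m0, m1, m2]
    revert j0 j1
    generalize h (y, 0) = a
    generalize h (y, 1) = b
    generalize h (y, 2) = c
    revert a b c
    decide
  rintro (⟨h0, h2⟩ | ⟨h0, h2⟩)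
  · exact vy (by rw [← hval _ _ h0, ← hval _ _ h2, vx])
  · exact vy (by rw [← hval _ _ h0, ← hval _ _ h2, vx])

theorem card_circle_insert_le (S : Finset (Fin D.c)) (x : Fin D.c) :
    Nat.card (Circle (D.stateOf (insert x S))) ≤ Nat.card (Circle (D.stateOf S)) + 1 := by
  by_cases hx : x ∈ S
  · rw [Finset.insert_eq_of_mem hx]; omega
  · rw [stateOf_insert]
    rcases merge_or_merge (D.stateOf S) x (if_neg hx) with h | h
    · have := h.card_eq; omega
    · exact h.card_eq.le

/-- Each change of a label from `A` to `B` makes at most one more circle. -/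
theorem card_circle_union_le (S T : Finset (Fin D.c)) (h : Disjoint S T) :
    Nat.card (Circle (D.stateOf (S ∪ T))) ≤ Nat.card (Circle (D.stateOf S)) + T.card := by
  induction T using Finset.induction_on with
  | empty => simp
  | insert x T hx ih =>
    rw [Finset.union_insert, Finset.card_insert_of_notMem hx]
    have := card_circle_insert_le (S ∪ T) x
    have := ih (Finset.disjoint_of_subset_right (Finset.subset_insert x T) h)
    omega

theorem merge_singleton {x : Fin D.c}
    (hA : circleOf D.stateA (x, 0) ≠ circleOf D.stateA (x, 2)) :
    Merge D.stateA (D.stateOf {x}) (x, 0) (x, 2) := by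
  have h : D.stateOf {x} = Function.update D.stateA x Label.B := by
    rw [← stateOf_empty, ← stateOf_insert]; rfl
  rw [h]
  rcases merge_or_merge D.stateA x rfl with h' | h'
  · exact h'
  · exact absurd ((h'.eq_iff _ _).2 (Or.inr ⟨Or.inl rfl,
      Or.inr (by rw [← h]; exact (circleOf_of_mem (by simp)).2)⟩)) hA

theorem card_circle_singleton {x : Fin D.c}
    (hA : circleOf D.stateA (x, 0) ≠ circleOf D.stateA (x, 2)) :
    Nat.card (Circle (D.stateOf {x})) + 1 = D.numCirclesA :=
  (merge_singleton hA).card_eq.symm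

/-- After one chord between two circles has joined them, each further chord between them splits a
circle. -/
theorem card_circle_of_parallel (hA : ∀ x : Fin D.c,
      circleOf D.stateA (x, 0) ≠ circleOf D.stateA (x, 2))
    (y₀ : Fin D.c) {S : Finset (Fin D.c)} (hS : S.Nonempty) (hpar : ∀ z ∈ S, chord z = chord y₀) :
    Nat.card (Circle (D.stateOf S)) + 2 = D.numCirclesA + S.card ∧
      ∀ x, x ∉ S → chord x = chord y₀ →
        circleOf (D.stateOf S) (x, 0) = circleOf (D.stateOf S) (x, 2) := by
  induction hS using Finset.Nonempty.cons_induction with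
  | singleton y =>
    refine ⟨?_, fun x hx hxy => ?_⟩
    · have := card_circle_singleton (hA y)
      rw [Finset.card_singleton]
      omega
    · rw [(merge_singleton (hA y)).eq_iff]
      have := hxy.trans (hpar y (by simp)).symm
      rcases Sym2.eq_iff.1 this with ⟨h0, h2⟩ | ⟨h0, h2⟩
      · exact Or.inr ⟨Or.inl h0, Or.inr h2⟩
      · exact Or.inr ⟨Or.inr h0, Or.inl h2⟩
  | cons y S hy hS ih =>
    rw [Finset.cons_eq_insert] at hpar ⊢
    obtain ⟨ih1, ih2⟩ := ih (fun z hz => hpar z (Finset.mem_insert_of_mem hz))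
    have hyc := hpar y (Finset.mem_insert_self _ _)
    have hsplit : Merge (D.stateOf (insert y S)) (D.stateOf S) (y, 0) (y, 1) := by
      rw [stateOf_insert]
      rcases merge_or_merge (D.stateOf S) y (if_neg hy) with h | h
      · exact absurd (ih2 y hy hyc) h.ne
      · exact h
    refine ⟨?_, fun x hx hxy => ?_⟩
    · have := hsplit.card_eq
      rw [Finset.card_insert_of_notMem hy]
      omega
    · have hxS : x ∉ S := fun h => hx (Finset.mem_insert_of_mem h)
      have hx02 := ih2 x hxS hxy
      rw [hsplit.eq_iff] at hx02
      have := not_interlaced hA (S := insert y S) (x := x) (y := y)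
        (fun z hz => (hpar z hz).trans hyc.symm) hx
        (hxy.trans hyc.symm) hsplit.ne
      rcases hx02 with h | ⟨h0 | h0, h2 | h2⟩
      · exact h
      · exact h0.trans h2.symm
      · exact absurd (Or.inl ⟨h0, h2⟩) this
      · exact absurd (Or.inr ⟨h0, h2⟩) this
      · exact h0.trans h2.symm

/-- Two chords between different pairs of circles join circles twice. -/
theorem card_circle_of_not_parallel (hA : ∀ x : Fin D.c,
      circleOf D.stateA (x, 0) ≠ circleOf D.stateA (x, 2))
    {S : Finset (Fin D.c)} {y z : Fin D.c} (hy : y ∈ S) (hz : z ∈ S) (hyz : chord y ≠ chord z) :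
    Nat.card (Circle (D.stateOf S)) + 4 ≤ D.numCirclesA + S.card := by
  have hne : z ≠ y := by rintro rfl; exact hyz rfl
  have h1 := card_circle_singleton (hA y)
  have h2 : Nat.card (Circle (D.stateOf {y})) = Nat.card (Circle (D.stateOf {z, y})) + 1 := by
    have hzy : z ∉ ({y} : Finset (Fin D.c)) := by simpa using hne
    rw [show ({z, y} : Finset (Fin D.c)) = insert z {y} from rfl, stateOf_insert]
    rcases merge_or_merge (D.stateOf {y}) z (if_neg hzy) with h | h
    · exact h.card_eq
    · exfalso
      have h02 : circleOf (D.stateOf {y}) (z, 0) = circleOf (D.stateOf {y}) (z, 2) := by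
        refine (h.eq_iff _ _).2 (Or.inr ⟨Or.inl rfl, Or.inr ?_⟩)
        rw [← stateOf_insert]
        exact (circleOf_of_mem (by simp)).2
      rw [(merge_singleton (hA y)).eq_iff] at h02
      rcases h02 with h | ⟨h0 | h0, h2 | h2⟩
      · exact hA z h
      · exact hA z (h0.trans h2.symm)
      · exact hyz (Sym2.eq_iff.2 (Or.inl ⟨h0.symm, h2.symm⟩))
      · exact hyz (Sym2.eq_iff.2 (Or.inr ⟨h2.symm, h0.symm⟩))
      · exact hA z (h0.trans h2.symm)
  have hsub : ({z, y} : Finset (Fin D.c)) ⊆ S := by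
    intro t; simp only [Finset.mem_insert, Finset.mem_singleton]; rintro (rfl | rfl) <;> assumption
  have h3 := card_circle_union_le {z, y} (S \ {z, y}) Finset.disjoint_sdiff
  rw [Finset.union_sdiff_of_subset hsub, Finset.card_sdiff_of_subset hsub,
    Finset.card_pair hne] at h3
  have h4 := Finset.card_le_card hsub
  rw [Finset.card_pair hne] at h4
  omega

end LinkDiagram

/-! ### The unsigned incidence matrix of a connected graph -/

namespace SimpleGraph

variable {V : Type} (H : SimpleGraph V)

/-- The sum of the values of a function at the ends of an edge. -/
def endSum {A : Type*} [AddCommMonoid A] (f : V → A) : Sym2 V → A :=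
  Sym2.lift ⟨fun u v => f u + f v, fun _ _ => add_comm _ _⟩

@[simp]
theorem endSum_mk {A : Type*} [AddCommMonoid A] (f : V → A) (u v : V) :
    endSum f s(u, v) = f u + f v := rfl

/-- The transposed unsigned incidence matrix of a graph. -/
def unsignedIncidence : (V → ℤ) →ₗ[ℤ] (H.edgeSet → ℤ) where
  toFun f e := endSum f e.1
  map_add' f g := by
    ext ⟨e, he⟩
    induction e using Sym2.ind with
    | _ u v => simp only [endSum_mk, Pi.add_apply]; ring
  map_smul' r f := by
    ext ⟨e, he⟩
    induction e using Sym2.ind with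
    | _ u v => simp only [endSum_mk, Pi.smul_apply, smul_eq_mul, RingHom.id_apply]; ring

variable {H}

theorem unsignedIncidence_eq_iff {f : V → ℤ} {g : H.edgeSet → ℤ} :
    H.unsignedIncidence f = g ↔
      ∀ u v (h : H.Adj u v), f u + f v = g ⟨s(u, v), h⟩ := by
  constructor
  · rintro rfl u v h
    rfl
  · intro h
    ext ⟨e, he⟩
    induction e using Sym2.ind with
    | _ u v => exact h u v he

theorem Connected.forall_of_adj (hH : H.Connected) {p : V → Prop} (v₀ : V) (h₀ : p v₀)
    (hp : ∀ u v, H.Adj u v → p u → p v) (v : V) : p v := by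
  have := (reachable_iff_reflTransGen v₀ v).1 (hH.preconnected v₀ v)
  induction this with
  | refl => exact h₀
  | tail _ h ih => exact hp _ _ h ih

/-- On a connected graph that is not bipartite, a function whose values at adjacent vertices are
opposite is constant, with a value of order at most 2: if `g v₀` and `-g v₀` were different, the
two values would be a proper 2-coloring. -/
theorem Connected.eq_of_add_eq_zero {A : Type*} [AddCommGroup A] (hH : H.Connected)
    (hnb : ¬ ∃ f : V → Bool, ∀ u v, H.Adj u v → f u ≠ f v) {g : V → A}
    (hg : ∀ u v, H.Adj u v → g u + g v = 0) (v₀ : V) :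
    (∀ v, g v = g v₀) ∧ g v₀ + g v₀ = 0 := by
  classical
  have h1 : ∀ v, g v = g v₀ ∨ g v = -g v₀ := by
    refine hH.forall_of_adj v₀ (Or.inl rfl) fun u v huv hu => ?_
    have hv : g v = -g u := (neg_eq_of_add_eq_zero_right (hg u v huv)).symm
    rcases hu with h | h
    · right; rw [hv, h]
    · left; rw [hv, h, neg_neg]
  have h2 : g v₀ + g v₀ = 0 := by
    by_contra hne
    have hne' : g v₀ ≠ -g v₀ := fun h => hne (eq_neg_iff_add_eq_zero.1 h)
    refine hnb ⟨fun v => decide (g v = g v₀), fun u v huv => ?_⟩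
    have hv : g v = -g u := (neg_eq_of_add_eq_zero_right (hg u v huv)).symm
    rcases h1 u with h | h
    · simp [hv, h, hne'.symm]
    · simp [hv, h, hne'.symm]
  refine ⟨fun v => ?_, h2⟩
  rcases h1 v with h | h
  · exact h
  · rw [h]; exact neg_eq_of_add_eq_zero_right h2

theorem finrank_coker_unsignedIncidence [Finite V] :
    Module.finrank ℤ ((H.edgeSet → ℤ) ⧸ LinearMap.range H.unsignedIncidence) + Nat.card V =
      Nat.card H.edgeSet + Module.finrank ℤ (LinearMap.ker H.unsignedIncidence) := by
  have := Fintype.ofFinite V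
  have := Fintype.ofFinite H.edgeSet
  have h1 := Submodule.finrank_quotient_add_finrank (LinearMap.range H.unsignedIncidence)
  have h2 := Submodule.finrank_quotient_add_finrank (LinearMap.ker H.unsignedIncidence)
  rw [LinearEquiv.finrank_eq H.unsignedIncidence.quotKerEquivRange] at h2
  rw [Module.finrank_fintype_fun_eq_card] at h1 h2
  rw [Nat.card_eq_fintype_card, Nat.card_eq_fintype_card]
  omega

theorem Connected.cyclomaticNumber_eq [Finite V] (hH : H.Connected) :
    cyclomaticNumber H = Nat.card H.edgeSet + 1 - Nat.card V := by
  have := hH.preconnected.subsingleton_connectedComponent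
  have : Nonempty H.ConnectedComponent := hH.nonempty.map H.connectedComponentMk
  rw [cyclomaticNumber, Nat.card_unique (α := H.ConnectedComponent)]

/-- For a connected bipartite graph, changing the signs of the values on one side turns the
unsigned incidence matrix into the coboundary of the graph. -/
theorem Connected.unsignedIncidence_of_bipartite [Finite V] (hH : H.Connected)
    (hb : ∃ f : V → Bool, ∀ u v, H.Adj u v → f u ≠ f v) :
    Nonempty (LinearMap.ker H.unsignedIncidence ≃ₗ[ℤ] ℤ) ∧
    Nonempty (((H.edgeSet → ℤ) ⧸ LinearMap.range H.unsignedIncidence) ≃ₗ[ℤ]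
      (Fin (cyclomaticNumber H) → ℤ)) := by
  obtain ⟨col, hcol⟩ := hb
  obtain ⟨v₀⟩ := hH.nonempty
  let ε : V → ℤ := fun v => if col v then 1 else -1
  have hε : ∀ v, ε v * ε v = 1 := fun v => by simp only [ε]; split_ifs <;> norm_num
  have hadj : ∀ u v, H.Adj u v → ε u + ε v = 0 := by
    intro u v huv
    have := hcol u v huv
    simp only [ε]
    revert this
    cases col u <;> cases col v <;> simp
  have hεM : ∀ a : ℤ, H.unsignedIncidence (fun v => ε v * a) = 0 := fun a =>
    unsignedIncidence_eq_iff.2 fun u v huv => by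
      rw [← add_mul, hadj u v huv, zero_mul]; rfl
  have hker : Nonempty (LinearMap.ker H.unsignedIncidence ≃ₗ[ℤ] ℤ) := by
    refine ⟨LinearEquiv.ofBijective
      ((LinearMap.proj v₀).comp (LinearMap.ker H.unsignedIncidence).subtype) ⟨?_, ?_⟩⟩
    · rw [injective_iff_map_eq_zero]
      rintro ⟨f, hf⟩ (h0 : f v₀ = 0)
      have hf' := unsignedIncidence_eq_iff.1 (LinearMap.mem_ker.1 hf)
      refine Subtype.ext (funext (hH.forall_of_adj v₀ h0 fun u v huv hu => ?_))
      have : f u + f v = 0 := hf' u v huv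
      have hu : f u = 0 := hu
      change f v = 0
      omega
    · intro a
      refine ⟨⟨fun v => ε v * (ε v₀ * a), LinearMap.mem_ker.2 (hεM _)⟩, ?_⟩
      change ε v₀ * (ε v₀ * a) = a
      rw [← mul_assoc, hε, one_mul]
  refine ⟨hker, ?_⟩
  have htf : Module.IsTorsionFree ℤ
      ((H.edgeSet → ℤ) ⧸ LinearMap.range H.unsignedIncidence) := by
    rw [Module.isTorsionFree_iff_smul_eq_zero]
    intro r q hq
    by_cases hr : r = 0
    · exact Or.inl hr
    right
    obtain ⟨g, rfl⟩ := Submodule.Quotient.mk_surjective _ q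
    rw [← Submodule.Quotient.mk_smul, Submodule.Quotient.mk_eq_zero] at hq
    obtain ⟨f, hf⟩ := hq
    rw [unsignedIncidence_eq_iff] at hf
    -- modulo `r` the function `f` is a multiple of `ε`
    have hdvd : ∀ v, r ∣ f v - ε v * (ε v₀ * f v₀) := by
      refine hH.forall_of_adj v₀ ?_ fun u v huv hu => ?_
      · rw [← mul_assoc, hε, one_mul, sub_self]; exact dvd_zero r
      · obtain ⟨p, hp⟩ : r ∣ f u + f v := ⟨_, hf u v huv⟩
        obtain ⟨q, hq⟩ := hu
        exact ⟨p - q, by linear_combination hp - hq - (ε v₀ * f v₀) * hadj u v huv⟩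
    choose k hk using hdvd
    rw [Submodule.Quotient.mk_eq_zero]
    refine ⟨k, unsignedIncidence_eq_iff.2 fun u v huv => mul_left_cancel₀ hr ?_⟩
    have h1 := hf u v huv
    have h2 : ε u = - ε v := eq_neg_of_add_eq_zero_left (hadj u v huv)
    have h3 := hk u
    have h4 := hk v
    rw [h2] at h3
    simp only [Pi.smul_apply, smul_eq_mul] at h1
    linear_combination h1 - h3 - h4
  refine ⟨LinearEquiv.ofFinrankEq _ _ ?_⟩
  have h1 := finrank_coker_unsignedIncidence (H := H)
  obtain ⟨e⟩ := hker
  rw [e.finrank_eq, Module.finrank_self] at h1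
  rw [hH.cyclomaticNumber_eq, Module.finrank_fin_fun]
  omega

/-- For a connected graph that is not bipartite, the torsion of the cokernel of the unsigned
incidence matrix is generated by the class of the constant function `1`, which is half of the
image of the constant function `1`. -/
theorem Connected.unsignedIncidence_of_not_bipartite [Finite V] (hH : H.Connected)
    (hnb : ¬ ∃ f : V → Bool, ∀ u v, H.Adj u v → f u ≠ f v) :
    Subsingleton (LinearMap.ker H.unsignedIncidence) ∧
    ∃ r : ℕ, cyclomaticNumber H = r + 1 ∧
      Nonempty (((H.edgeSet → ℤ) ⧸ LinearMap.range H.unsignedIncidence) ≃ₗ[ℤ]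
        ((Fin r → ℤ) × ZMod 2)) := by
  obtain ⟨v₀⟩ := hH.nonempty
  have hker : LinearMap.ker H.unsignedIncidence = ⊥ := by
    rw [eq_bot_iff]
    intro f hf
    have hf' := unsignedIncidence_eq_iff.1 (LinearMap.mem_ker.1 hf)
    obtain ⟨h1, h2⟩ := hH.eq_of_add_eq_zero hnb (g := f) hf' v₀
    have h3 : f v₀ = 0 := by omega
    exact (Submodule.mem_bot ℤ).2 (funext fun v => (h1 v).trans h3)
  refine ⟨hker ▸ inferInstance, ?_⟩
  set C := (H.edgeSet → ℤ) ⧸ LinearMap.range H.unsignedIncidence with hC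
  let t : C := Submodule.Quotient.mk 1
  have h2t : t + t = 0 := by
    rw [← Submodule.Quotient.mk_add, Submodule.Quotient.mk_eq_zero]
    exact ⟨1, unsignedIncidence_eq_iff.2 fun u v huv => rfl⟩
  have ht : t ≠ 0 := by
    intro h
    rw [Submodule.Quotient.mk_eq_zero] at h
    obtain ⟨f, hf⟩ := h
    rw [unsignedIncidence_eq_iff] at hf
    refine hnb ⟨fun v => decide (f v % 2 = 0), fun u v huv => ?_⟩
    have h1 : f u + f v = 1 := hf u v huv
    intro h
    have h2 : f u % 2 = 0 ↔ f v % 2 = 0 := by simpa using h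
    omega
  let jj : ZMod 2 →+ C := ZMod.lift 2 ⟨zmultiplesHom C t, by
    rw [zmultiplesHom_apply]; simpa [two_zsmul] using h2t⟩
  have hjj : ∀ n : ℤ, jj (n : ZMod 2) = n • t := fun n => by
    simp only [jj, ZMod.lift_coe, zmultiplesHom_apply]
  let j : ZMod 2 →ₗ[ℤ] C := jj.toIntLinearMap
  have hj : Function.Injective j := by
    rw [injective_iff_map_eq_zero]
    intro a ha
    fin_cases a
    · rfl
    · exfalso
      apply ht
      have := hjj 1
      rw [one_zsmul] at this
      rw [← this]
      exact ha
  let g : C →ₗ[ℤ] (C ⧸ LinearMap.range j) := Submodule.mkQ _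
  have htf : Module.IsTorsionFree ℤ (C ⧸ LinearMap.range j) := by
    rw [Module.isTorsionFree_iff_smul_eq_zero]
    intro r q hq
    by_cases hr : r = 0
    · exact Or.inl hr
    right
    obtain ⟨q, rfl⟩ := Submodule.Quotient.mk_surjective _ q
    obtain ⟨g, rfl⟩ := Submodule.Quotient.mk_surjective _ q
    rw [← Submodule.Quotient.mk_smul, Submodule.Quotient.mk_eq_zero] at hq
    obtain ⟨a, ha⟩ := hq
    obtain ⟨b, rfl⟩ := ZMod.intCast_surjective a
    have hb : b • t = r • (Submodule.Quotient.mk g : C) := (hjj b).symm.trans ha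
    rw [← Submodule.Quotient.mk_smul, ← Submodule.Quotient.mk_smul, eq_comm,
      Submodule.Quotient.eq] at hb
    obtain ⟨f, hf⟩ := hb
    rw [unsignedIncidence_eq_iff] at hf
    have hf' : ∀ u v (h : H.Adj u v), f u + f v = r * g ⟨s(u, v), h⟩ - b := by
      intro u v h
      have := hf u v h
      simpa using this
    -- modulo `2 r` the function `2 f + b` takes opposite values at adjacent vertices
    have hcast : ∀ a : ℤ, ((a : ZMod (2 * r).natAbs) = 0) ↔ 2 * r ∣ a := fun a => by
      rw [ZMod.intCast_zmod_eq_zero_iff_dvd, Int.natAbs_dvd]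
    obtain ⟨h1, h2⟩ := hH.eq_of_add_eq_zero hnb
      (g := fun v => ((2 * f v + b : ℤ) : ZMod (2 * r).natAbs)) (fun u v huv => by
        rw [← Int.cast_add, hcast]
        exact ⟨g ⟨s(u, v), huv⟩, by linear_combination 2 * hf' u v huv⟩) v₀
    rw [← Int.cast_add, hcast] at h2
    obtain ⟨a, ha⟩ := h2
    have ha' : 2 * f v₀ + b = r * a := by linarith
    have hdvd : ∀ v, 2 * r ∣ (2 * f v + b) - (2 * f v₀ + b) := fun v => by
      rw [← hcast, Int.cast_sub]
      exact sub_eq_zero.2 (h1 v)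
    choose k hk using hdvd
    rw [Submodule.Quotient.mk_eq_zero]
    refine ⟨(a : ZMod 2), ?_⟩
    refine (hjj a).trans ?_
    rw [← Submodule.Quotient.mk_smul, eq_comm, Submodule.Quotient.eq]
    refine ⟨k, unsignedIncidence_eq_iff.2 fun u v huv => mul_left_cancel₀ hr ?_⟩
    have e1 := hf' u v huv
    have e2 := hk u
    have e3 := hk v
    have e4 : r * k u = f u - f v₀ := by linarith
    have e5 : r * k v = f v - f v₀ := by linarith
    simp only [Pi.sub_apply, Pi.smul_apply, Pi.one_apply, smul_eq_mul, mul_one]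
    linear_combination e4 + e5 + e1 - ha'
  -- the quotient by the torsion is free, so it splits off
  obtain ⟨f, hf⟩ := Module.projective_lifting_property g LinearMap.id
    (Submodule.mkQ_surjective _)
  have e := lequivProdOfRightSplitExact hj (Submodule.ker_mkQ _).symm hf
  have hrank : Module.finrank ℤ (C ⧸ LinearMap.range j) + Nat.card V = Nat.card H.edgeSet := by
    have h1 := finrank_coker_unsignedIncidence (H := H)
    rw [hker, finrank_bot, add_zero] at h1
    change Module.finrank ℤ C + _ = _ at h1
    have h2 := Submodule.finrank_quotient_add_finrank (LinearMap.range j)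
    have h3 : Module.finrank ℤ (LinearMap.range j) = 0 := by
      rw [Module.finrank_eq_zero_iff]
      rintro ⟨_, a, rfl⟩
      refine ⟨2, two_ne_zero, Subtype.ext ?_⟩
      change (2 : ℤ) • j a = 0
      rw [← map_smul]
      have : (2 : ℤ) • a = 0 := by revert a; decide
      rw [this, map_zero]
    omega
  refine ⟨Module.finrank ℤ (C ⧸ LinearMap.range j), ?_, ⟨?_⟩⟩
  · rw [hH.cyclomaticNumber_eq]
    omega
  · exact e.symm.trans ((LinearEquiv.prodComm ℤ _ _).trans
      (LinearEquiv.prodCongr (Module.finBasis ℤ _).equivFun (LinearEquiv.refl ℤ _)))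

end SimpleGraph

/-! ### The boundary of the partial presimplicial set -/

namespace PartialPresimplicial

variable {V : Type} {c : ℕ} {G : Graph V (Fin c)} {q : ℕ}

namespace Simplex

/-- The edges that occur in a simplex; all of them, if the simplex is a vertex of `G`. -/
def edges : Simplex G q → Finset (Fin c)
  | top _ _ _ => Finset.univ
  | sub _ w _ _ => w

/-- The vertex of `G` that is a simplex of top dimension. -/
def vertex? : Simplex G q → Option V
  | top _ T _ => some T
  | sub _ _ _ _ => none

theorem card_edges (a : Simplex G q) : a.edges.card = q := by
  cases a with
  | top hq T hT => simp [edges, hq]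
  | sub hq w hw hpar => exact hw

theorem ext_of_edges {a b : Simplex G q} (h : a.edges = b.edges) (hv : a.vertex? = b.vertex?) :
    a = b := by
  cases a with
  | top hq T hT =>
    cases b with
    | top hq' T' hT' =>
      obtain rfl : T = T' := Option.some_injective _ hv
      rfl
    | sub hq' w hw hpar => cases hv
  | sub hq w hw hpar =>
    cases b with
    | top hq' T' hT' => cases hv
    | sub hq' w' hw' hpar' =>
      obtain rfl : w = w' := h
      rfl

theorem vertex?_eq_none (hq : q < c) (a : Simplex G q) : a.vertex? = none := by
  cases a with
  | top hq' T hT => omega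
  | sub hq' w hw hpar => rfl

theorem parallelOutside (hq : q < c) (a : Simplex G q) : ParallelOutside G a.edges := by
  cases a with
  | top hq' T hT => omega
  | sub hq' w hw hpar => exact hpar

theorem ext_of_lt (hq : q < c) {a b : Simplex G q} (h : a.edges = b.edges) : a = b :=
  ext_of_edges h (by rw [vertex?_eq_none hq, vertex?_eq_none hq])

theorem le_card (a : Simplex G q) : q ≤ c := by
  cases a <;> omega

instance [Finite V] : Finite (Simplex G q) :=
  Finite.of_injective (fun a => (a.edges, a.vertex?)) fun _ _ h =>
    ext_of_edges (congrArg Prod.fst h) (congrArg Prod.snd h)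

end Simplex

/-- The number of elements of `w` that are smaller than `x`. -/
def below (w : Finset (Fin c)) (x : Fin c) : ℕ := (w.filter (· < x)).card

theorem below_orderEmbOfFin {w : Finset (Fin c)} {n : ℕ} (hw : w.card = n) (i : Fin n) :
    below w (w.orderEmbOfFin hw i) = i := by
  have : w.filter (· < w.orderEmbOfFin hw i) =
      (Finset.Iio i).map (w.orderEmbOfFin hw).toEmbedding := by
    ext x
    simp only [Finset.mem_filter, Finset.mem_map, Finset.mem_Iio, RelEmbedding.coe_toEmbedding]
    constructor
    · rintro ⟨hx, hlt⟩
      rw [← Finset.mem_coe, ← Finset.range_orderEmbOfFin w hw] at hx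
      obtain ⟨k, rfl⟩ := hx
      exact ⟨k, (w.orderEmbOfFin hw).lt_iff_lt.1 hlt, rfl⟩
    · rintro ⟨k, hk, rfl⟩
      exact ⟨Finset.orderEmbOfFin_mem w hw k, (w.orderEmbOfFin hw).lt_iff_lt.2 hk⟩
  rw [below, this, Finset.card_map, Fin.card_Iio]

theorem below_univ (x : Fin c) : below Finset.univ x = x := by
  have : (Finset.univ.filter (· < x)) = Finset.Iio x := by ext; simp
  rw [below, this, Fin.card_Iio]

theorem below_insert {w : Finset (Fin c)} {x : Fin c} (hx : x ∉ w) (y : Fin c) :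
    below (insert x w) y = below w y + if x < y then 1 else 0 := by
  unfold below
  rw [Finset.filter_insert]
  split_ifs with h
  · rw [Finset.card_insert_of_notMem (by simp [hx])]
  · rfl

theorem below_erase_self (w : Finset (Fin c)) (x : Fin c) : below (w.erase x) x = below w x := by
  unfold below
  congr 1
  ext y
  simp only [Finset.mem_filter, Finset.mem_erase]
  exact ⟨fun h => ⟨h.1.2, h.2⟩, fun h => ⟨⟨h.2.ne, h.1⟩, h.2⟩⟩

/-- The simplex `b` is the face of `a` that omits the edge `x`. -/
def IsFaceAt (x : Fin c) (a : Simplex G (q + 1)) (b : Simplex G q) : Prop :=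
  x ∈ a.edges ∧ b.edges = a.edges.erase x ∧ ∀ T, a.vertex? = some T → G.Inc x T

open Classical in
theorem boundary_single_apply (a : Simplex G (q + 1)) (b : Simplex G q) :
    boundary G q (Finsupp.single a 1) b =
      ∑ x, if IsFaceAt x a b then (-1) ^ below a.edges x else 0 := by
  have hq : q < c := by have := a.le_card; omega
  have h1 : boundary G q (Finsupp.single a 1) b =
      ∑ i : Fin (q + 1), (-1 : ℤ) ^ (i : ℕ) * if face i a = some b then 1 else 0 := by
    simp only [boundary, Finsupp.lift_apply]
    rw [Finsupp.sum_single_index (by simp), one_smul, Finsupp.finsetSum_apply]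
    refine Finset.sum_congr rfl fun i _ => ?_
    rw [Finsupp.smul_apply, smul_eq_mul]
    cases face i a with
    | none => simp
    | some b' => simp [Finsupp.single_apply]
  rw [h1]
  cases a with
  | top hq' T hT =>
    have hf : ∀ i, face i (Simplex.top hq' T hT) = some b ↔
        IsFaceAt (Fin.cast hq' i) (Simplex.top hq' T hT) b := by
      intro i
      simp only [face, IsFaceAt, Simplex.edges, Simplex.vertex?, Finset.mem_univ, true_and,
        Option.some.injEq, forall_eq']
      split_ifs with h
      · rw [Option.some_inj]
        constructor
        · rintro rfl
          exact ⟨rfl, h⟩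
        · rintro ⟨hb, -⟩
          exact Simplex.ext_of_lt hq hb.symm
      · simp [h]
    rw [← Equiv.sum_comp (finCongr hq')]
    refine Finset.sum_congr rfl fun i _ => ?_
    simp only [hf, Simplex.edges, below_univ, finCongr_apply, Fin.val_cast, mul_ite, mul_one,
      mul_zero]
  | sub hq' w hw hpar =>
    have hf : ∀ i, face i (Simplex.sub hq' w hw hpar) = some b ↔
        IsFaceAt (w.orderEmbOfFin hw i) (Simplex.sub hq' w hw hpar) b := by
      intro i
      simp only [face, IsFaceAt, Simplex.edges, Simplex.vertex?, Finset.orderEmbOfFin_mem,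
        true_and, reduceCtorEq, false_implies, implies_true, and_true]
      split_ifs with h
      · rw [Option.some_inj]
        constructor
        · rintro rfl
          rfl
        · intro hb
          exact Simplex.ext_of_lt hq hb.symm
      · simp only [false_iff]
        intro hb
        exact h (hb ▸ b.parallelOutside hq)
    have h2 : ∀ x ∉ w, ¬ IsFaceAt x (Simplex.sub hq' w hw hpar) b := fun x hx h => hx h.1
    rw [← Finset.sum_subset (Finset.subset_univ w) (fun x _ hx => if_neg (h2 x hx))]
    have h3 : ∀ F : Fin c → ℤ, ∑ x ∈ w, F x = ∑ i, F (w.orderEmbOfFin hw i) := fun F => by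
      conv_lhs => rw [← Finset.map_orderEmbOfFin_univ w hw, Finset.sum_map]
      rfl
    rw [h3]
    refine Finset.sum_congr rfl fun i _ => ?_
    simp only [hf, Simplex.edges, below_orderEmbOfFin, mul_ite,
      mul_one, mul_zero]

end PartialPresimplicial

/-! ### The boundary in coordinates -/

namespace PartialPresimplicial

variable {V : Type} {c : ℕ} {G : Graph V (Fin c)} {q : ℕ}

open Classical in
/-- The coefficient of the simplex with edges `w` in a chain below the top dimension, and `0` if
there is no such simplex. -/
noncomputable def coeff (z : Simplex G q →₀ ℤ) (w : Finset (Fin c)) : ℤ :=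
  if h : q < c ∧ w.card = q ∧ ParallelOutside G w then z (Simplex.sub h.1 w h.2.1 h.2.2) else 0

theorem coeff_edges (hq : q < c) (z : Simplex G q →₀ ℤ) (a : Simplex G q) :
    coeff z a.edges = z a := by
  rw [coeff, dif_pos ⟨hq, a.card_edges, a.parallelOutside hq⟩]
  exact congrArg z (Simplex.ext_of_lt hq rfl)

theorem coeff_single (hq : q < c) (a : Simplex G q) (n : ℤ) (w : Finset (Fin c)) :
    coeff (Finsupp.single a n) w = if a.edges = w then n else 0 := by
  split_ifs with h
  · rw [← h, coeff_edges hq, Finsupp.single_eq_same]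
  · rw [coeff]
    split_ifs with h'
    · exact Finsupp.single_eq_of_ne (by rintro rfl; exact h rfl)
    · rfl

theorem coeff_add (z z' : Simplex G q →₀ ℤ) (w : Finset (Fin c)) :
    coeff (z + z') w = coeff z w + coeff z' w := by
  unfold coeff
  split_ifs <;> simp

theorem coeff_zero (w : Finset (Fin c)) : coeff (0 : Simplex G q →₀ ℤ) w = 0 := by
  unfold coeff
  split_ifs <;> simp

/-- The boundary below the top dimension, in coordinates. -/
theorem boundary_apply_of_lt (hq : q + 1 < c) (z : Simplex G (q + 1) →₀ ℤ) (b : Simplex G q) :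
    boundary G q z b =
      ∑ x ∈ b.edgesᶜ, (-1) ^ below b.edges x * coeff z (insert x b.edges) := by
  classical
  induction z using Finsupp.induction_linear with
  | zero => simp [coeff_zero]
  | add z z' hz hz' =>
    rw [map_add, Finsupp.add_apply, hz, hz', ← Finset.sum_add_distrib]
    simp only [coeff_add, mul_add]
  | single a n =>
    have : Finsupp.single a n = n • Finsupp.single a (1 : ℤ) := by simp
    rw [this, map_smul, Finsupp.smul_apply, boundary_single_apply, ← this,
      ← Finset.sum_subset (Finset.subset_univ b.edgesᶜ), smul_eq_mul, Finset.mul_sum]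
    · refine Finset.sum_congr rfl fun x hx => ?_
      rw [Finset.mem_compl] at hx
      have hiff : IsFaceAt x a b ↔ a.edges = insert x b.edges := by
        simp only [IsFaceAt, Simplex.vertex?_eq_none hq, reduceCtorEq, false_implies,
          implies_true, and_true]
        constructor
        · rintro ⟨h1, h2⟩
          rw [h2, Finset.insert_erase h1]
        · intro h
          rw [h, Finset.erase_insert hx]
          exact ⟨Finset.mem_insert_self _ _, rfl⟩
      rw [coeff_single hq]
      by_cases h : a.edges = insert x b.edges
      · rw [if_pos (hiff.2 h), if_pos h, h, ← below_erase_self, Finset.erase_insert hx, mul_comm]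
      · rw [if_neg (fun h' => h (hiff.1 h')), if_neg h, mul_zero, mul_zero]
    · intro x _ hx
      refine if_neg fun h => hx ?_
      rw [Finset.mem_compl, h.2.1]
      simp

/-- The boundary in the top dimension, in coordinates. -/
theorem boundary_apply_of_eq [G.Loopless] (hq : q + 1 = c) (z : Simplex G (q + 1) →₀ ℤ)
    (b : Simplex G q) {x : Fin c} (hb : b.edges = Finset.univ.erase x) {u v : V}
    (hx : G.IsLink x u v) :
    boundary G q z b = (-1) ^ (x : ℕ) *
      (z (Simplex.top hq u hx.left_mem) + z (Simplex.top hq v hx.right_mem)) := by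
  classical
  induction z using Finsupp.induction_linear with
  | zero => simp
  | add z z' hz hz' =>
    rw [map_add, Finsupp.add_apply, hz, hz', Finsupp.add_apply, Finsupp.add_apply]
    ring
  | single a n =>
    have : Finsupp.single a n = n • Finsupp.single a (1 : ℤ) := by simp
    rw [this, map_smul, Finsupp.smul_apply, boundary_single_apply, ← this]
    cases a with
    | sub hq' w hw hpar => omega
    | top hq' T hT =>
      rw [Finset.sum_eq_single x]
      · have hiff : IsFaceAt x (Simplex.top hq' T hT) b ↔ T = u ∨ T = v := by
          constructor
          · rintro ⟨-, -, h⟩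
            obtain ⟨y, hy⟩ := h T rfl
            exact hy.left_eq_or_eq hx
          · intro h
            refine ⟨Finset.mem_univ _, hb, fun T' hT' => ?_⟩
            obtain rfl : T = T' := Option.some_injective _ hT'
            rcases h with rfl | rfl
            · exact hx.inc_left
            · exact hx.inc_right
        have htop : ∀ t ht, Finsupp.single (Simplex.top hq' T hT) n (Simplex.top hq t ht) =
            if T = t then n else 0 := by
          intro t ht
          rw [Finsupp.single_apply]
          simp only [Simplex.top.injEq]
        have huv : u ≠ v := hx.ne
        rw [htop, htop]
        simp only [hiff, Simplex.edges, below_univ, smul_eq_mul]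
        by_cases h1 : T = u
        · subst h1
          simp [huv, mul_comm]
        · by_cases h2 : T = v
          · subst h2
            simp [h1, mul_comm]
          · simp [h1, h2]
      · intro y _ hy
        refine if_neg fun h => hy ?_
        have h2 := h.2.1
        rw [hb] at h2
        by_contra hne
        have : y ∈ Finset.univ.erase x := by simp [hne]
        rw [h2] at this
        simp [Simplex.edges] at this
      · simp

/-- The edges of `G` map onto the edges of the underlying simple graph, and the fibers are the
parallel classes. -/
theorem exists_edgeClass [G.Loopless] (hE : G.edgeSet = Set.univ) :
    ∃ cl : Fin c → G.toSimpleGraph.edgeSet, Function.Surjective cl ∧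
      ∀ x (u v : G.vertexSet), G.IsLink x u v ↔ (cl x).1 = s(u, v) := by
  have h : ∀ x, ∃ p : Sym2 G.vertexSet, p ∈ G.toSimpleGraph.edgeSet ∧
      ∀ u v : G.vertexSet, G.IsLink x u v ↔ p = s(u, v) := by
    intro x
    obtain ⟨u, v, huv⟩ := (G.edge_mem_iff_exists_isLink x).1 (hE ▸ Set.mem_univ x)
    refine ⟨s(⟨u, huv.left_mem⟩, ⟨v, huv.right_mem⟩), ?_, ?_⟩
    · rw [SimpleGraph.mem_edgeSet, Graph.toSimpleGraph_adj_iff]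
      exact ⟨x, huv⟩
    · rintro ⟨u', hu'⟩ ⟨v', hv'⟩
      rw [Sym2.eq_iff]
      simp only [Subtype.mk.injEq]
      constructor
      · intro h
        exact huv.eq_and_eq_or_eq_and_eq h
      · rintro (⟨rfl, rfl⟩ | ⟨rfl, rfl⟩)
        · exact huv
        · exact huv.symm
  choose p hp hpl using h
  refine ⟨fun x => ⟨p x, hp x⟩, ?_, hpl⟩
  rintro ⟨e, he⟩
  induction e using Sym2.ind with
  | _ u v =>
    have h1 := he
    rw [SimpleGraph.mem_edgeSet, Graph.toSimpleGraph_adj_iff] at h1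
    obtain ⟨x, hx⟩ := h1
    exact ⟨x, Subtype.ext ((hpl x u v).1 hx)⟩

/-- The reference edge `x₀` may itself belong to `w`. -/
theorem parallelOutside_of_cl {cl : Fin c → G.toSimpleGraph.edgeSet}
    (hcl : ∀ x (u v : G.vertexSet), G.IsLink x u v ↔ (cl x).1 = s(u, v))
    {w : Finset (Fin c)} {x₀ : Fin c} (h : ∀ x ∉ w, cl x = cl x₀) : ParallelOutside G w := by
  obtain ⟨e, he⟩ : ∃ e, e = (cl x₀).1 := ⟨_, rfl⟩
  induction e using Sym2.ind with
  | _ u v => exact ⟨u, v, fun x hx => (hcl x u v).2 (by rw [h x hx, he])⟩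

theorem ParallelOutside.cl_eq {cl : Fin c → G.toSimpleGraph.edgeSet}
    (hcl : ∀ x (u v : G.vertexSet), G.IsLink x u v ↔ (cl x).1 = s(u, v))
    {w : Finset (Fin c)} (h : ParallelOutside G w) {x y : Fin c} (hx : x ∉ w) (hy : y ∉ w) :
    cl x = cl y := by
  obtain ⟨u, v, huv⟩ := h
  have h1 := huv x hx
  have h2 := huv y hy
  have h3 := (hcl x ⟨u, h1.left_mem⟩ ⟨v, h1.right_mem⟩).1 h1
  have h4 := (hcl y ⟨u, h1.left_mem⟩ ⟨v, h1.right_mem⟩).1 h2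
  exact Subtype.ext (h3.trans h4.symm)

end PartialPresimplicial

/-! ### The homology of the partial presimplicial set -/

namespace PartialPresimplicial

variable {V : Type} {c : ℕ} {G : Graph V (Fin c)} {q : ℕ}

theorem subsingleton_homology_of_gt (hq : c < q) : Subsingleton (Homology G q) := by
  have : IsEmpty (Simplex G q) := ⟨fun a => by have := a.le_card; omega⟩
  infer_instance

theorem neg_one_pow_mul_self (n : ℕ) : (-1 : ℤ) ^ n * (-1) ^ n = 1 := by
  rw [← mul_pow]; simp

/-- Removing two edges from a set in the two possible orders yields opposite signs. -/
theorem sign_insert_insert {w : Finset (Fin c)} {x y : Fin c} (hx : x ∉ w) (hy : y ∉ w)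
    (hxy : x ≠ y) :
    (-1 : ℤ) ^ below (insert y w) x * (-1) ^ below (insert x w) y =
      -((-1) ^ below w x * (-1) ^ below w y) := by
  rw [below_insert hx, below_insert hy]
  rcases lt_or_gt_of_ne hxy with h | h
  · simp [h, h.not_gt, pow_succ]
  · simp [h, h.not_gt, pow_succ]

/-- Below dimension `c - 2` the homology vanishes: the simplices for one parallel class form the
cochain complex of a full simplex, with omitted edges as vertices, and omitting an edge chosen in
each class is a contraction. -/
theorem subsingleton_homology_of_lt [G.Loopless] [Finite V] (hE : G.edgeSet = Set.univ)
    (hq : q + 1 < c) : Subsingleton (Homology G q) := by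
  classical
  obtain ⟨cl, hsurj, hcl⟩ := exists_edgeClass (G := G) hE
  rw [Submodule.Quotient.subsingleton_iff, eq_top_iff]
  rintro ⟨z, hz⟩ -
  change z ∈ LinearMap.range (boundary G q)
  let ρ : Fin c → Fin c := fun x => Function.surjInv hsurj (cl x)
  have hρ : ∀ x, cl (ρ x) = cl x := fun x => Function.surjInv_eq hsurj (cl x)
  -- the chosen edge of the class of the edges outside `w`
  let r : Finset (Fin c) → Fin c := fun w =>
    if h : ∃ x, x ∉ w then ρ h.choose else ⟨0, by omega⟩
  have hr : ∀ w x, ParallelOutside G w → x ∉ w → r w = ρ x := by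
    intro w x hw hx
    have h : ∃ x, x ∉ w := ⟨x, hx⟩
    simp only [r, dif_pos h, ρ]
    rw [hw.cl_eq hcl h.choose_spec hx]
  -- the contraction: the class of the edges outside a simplex stays the same when the chosen edge
  -- is moved from the simplex to its complement
  let f : Simplex G (q + 1) → ℤ := fun a =>
    if r a.edges ∈ a.edges then
      (-1) ^ below (a.edges.erase (r a.edges)) (r a.edges) * coeff z (a.edges.erase (r a.edges))
    else 0
  let y : Simplex G (q + 1) →₀ ℤ := Finsupp.equivFunOnFinite.symm f
  refine ⟨y, Finsupp.ext fun b => ?_⟩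
  have hbpar := b.parallelOutside (by omega)
  obtain ⟨e, he⟩ : ∃ e, e = r b.edges := ⟨_, rfl⟩
  have hre : ∀ w, ParallelOutside G w → (∃ x, x ∉ w ∧ x ∉ b.edges) → r w = e := by
    rintro w hw ⟨x, hx, hxb⟩
    rw [hr w x hw hx, he, hr b.edges x hbpar hxb]
  have hcle : ∀ x, x ∉ b.edges → cl e = cl x := fun x hx => by
    rw [he, hr b.edges x hbpar hx, hρ]
  have hy : ∀ x, x ∉ b.edges → coeff y (insert x b.edges) =
      if e ∈ insert x b.edges then
        (-1) ^ below ((insert x b.edges).erase e) e * coeff z ((insert x b.edges).erase e)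
      else 0 := by
    intro x hx
    have hcard : (insert x b.edges).card = q + 1 := by
      rw [Finset.card_insert_of_notMem hx, b.card_edges]
    have hpar : ParallelOutside G (insert x b.edges) := by
      obtain ⟨u, v, h⟩ := hbpar
      exact ⟨u, v, fun t ht => h t fun h' => ht (Finset.mem_insert_of_mem h')⟩
    have hex : ∃ t, t ∉ insert x b.edges ∧ t ∉ b.edges := by
      by_contra h
      push Not at h
      have : insert x b.edges = Finset.univ := by
        refine Finset.eq_univ_iff_forall.2 fun t => ?_
        by_contra ht
        exact ht (Finset.mem_insert_of_mem (h t ht))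
      rw [this, Finset.card_univ, Fintype.card_fin] at hcard
      omega
    have hre' := hre _ hpar hex
    rw [coeff, dif_pos ⟨hq, hcard, hpar⟩]
    change (if r (insert x b.edges) ∈ insert x b.edges then
      (-1) ^ below ((insert x b.edges).erase (r (insert x b.edges))) (r (insert x b.edges)) *
        coeff z ((insert x b.edges).erase (r (insert x b.edges))) else 0) = _
    rw [hre']
  rw [boundary_apply_of_lt hq, Finset.sum_congr rfl fun x hx => by
    rw [hy x (Finset.mem_compl.1 hx)]]
  by_cases heb : e ∈ b.edges
  · -- the equation of a cycle at the simplex without `e`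
    obtain ⟨w₀, hw₀, hew₀⟩ : ∃ w₀, b.edges = insert e w₀ ∧ e ∉ w₀ :=
      ⟨b.edges.erase e, (Finset.insert_erase heb).symm, Finset.notMem_erase _ _⟩
    have hcard : w₀.card + 1 = q := by
      rw [← Finset.card_insert_of_notMem hew₀, ← hw₀, b.card_edges]
    obtain ⟨q', rfl⟩ : ∃ q', q = q' + 1 := ⟨w₀.card, hcard.symm⟩
    have hpar₀ : ParallelOutside G w₀ := by
      refine parallelOutside_of_cl hcl (x₀ := e) fun x hx => ?_
      by_cases hxe : x = e
      · rw [hxe]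
      · refine (hcle x ?_).symm
        rw [hw₀]
        simp [hxe, hx]
    have hcyc : boundary G q' z = 0 := hz
    have h0 := DFunLike.congr_fun hcyc (Simplex.sub (by omega) w₀ (by omega) hpar₀)
    rw [boundary_apply_of_lt (by omega)] at h0
    change ∑ x ∈ w₀ᶜ, (-1) ^ below w₀ x * coeff z (insert x w₀) = 0 at h0
    have hsplit : w₀ᶜ = insert e b.edgesᶜ := by
      rw [hw₀, Finset.compl_insert, Finset.insert_erase (Finset.mem_compl.2 hew₀)]
    rw [hsplit, Finset.sum_insert (by simp [heb]), ← hw₀, coeff_edges (by omega)] at h0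
    have hterm : ∀ x ∈ b.edgesᶜ, (-1) ^ below b.edges x *
        (if e ∈ insert x b.edges then
          (-1) ^ below ((insert x b.edges).erase e) e * coeff z ((insert x b.edges).erase e)
        else 0) = -(-1) ^ below w₀ e * ((-1) ^ below w₀ x * coeff z (insert x w₀)) := by
      intro x hx
      rw [Finset.mem_compl] at hx
      have hxe : x ≠ e := by rintro rfl; exact hx heb
      have hxw : x ∉ w₀ := fun h => hx (hw₀ ▸ Finset.mem_insert_of_mem h)
      rw [if_pos (Finset.mem_insert_of_mem heb)]
      have : (insert x b.edges).erase e = insert x w₀ := by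
        rw [hw₀, Finset.insert_comm, Finset.erase_insert (by simp [hew₀, hxe.symm])]
      rw [this, hw₀, ← mul_assoc, sign_insert_insert hxw hew₀ hxe]
      ring
    rw [Finset.sum_congr rfl hterm, ← Finset.mul_sum]
    have h1 := neg_one_pow_mul_self (below w₀ e)
    linear_combination (-(-1) ^ below w₀ e) * h0 + z b * h1
  · rw [Finset.sum_eq_single_of_mem e (Finset.mem_compl.2 heb)]
    · rw [if_pos (Finset.mem_insert_self _ _), Finset.erase_insert heb, ← mul_assoc,
        neg_one_pow_mul_self, one_mul, coeff_edges (by omega)]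
    · intro x _ hxe
      rw [if_neg (by simp [hxe.symm, heb]), mul_zero]

/-- In the top dimension the homology is the kernel of the unsigned incidence matrix. -/
theorem homology_top [G.Loopless] [Finite V] (hE : G.edgeSet = Set.univ) :
    Nonempty (Homology G c ≃ₗ[ℤ] LinearMap.ker G.toSimpleGraph.unsignedIncidence) := by
  classical
  obtain ⟨cl, hsurj, hcl⟩ := exists_edgeClass (G := G) hE
  have : IsEmpty (Simplex G (c + 1)) := ⟨fun a => by have := a.le_card; omega⟩
  have hbot : (LinearMap.range (boundary G c)).submoduleOf (cycles G c) = ⊥ := by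
    rw [eq_bot_iff]
    rintro ⟨_, hz⟩ ⟨y, rfl⟩
    have : y = 0 := Subsingleton.elim _ _
    rw [Submodule.mem_bot]
    exact Subtype.ext (by simp [this])
  let E : G.vertexSet ≃ Simplex G c :=
    { toFun := fun T => Simplex.top rfl T.1 T.2
      invFun := fun a => match a with
        | Simplex.top _ T hT => ⟨T, hT⟩
        | Simplex.sub hq _ _ _ => absurd hq (lt_irrefl c)
      left_inv := fun T => rfl
      right_inv := fun a => by
        cases a with
        | top hq T hT => rfl
        | sub hq w hw hpar => omega }
  let L : (Simplex G c →₀ ℤ) ≃ₗ[ℤ] (G.vertexSet → ℤ) :=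
    (Finsupp.linearEquivFunOnFinite ℤ ℤ _).trans (LinearEquiv.funCongrLeft ℤ ℤ E)
  have hL : ∀ z T, L z T = z (Simplex.top rfl T.1 T.2) := fun z T => rfl
  have hmap : ∀ z, z ∈ cycles G c ↔
      L z ∈ LinearMap.ker G.toSimpleGraph.unsignedIncidence := by
    intro z
    rw [LinearMap.mem_ker, SimpleGraph.unsignedIncidence_eq_iff]
    cases c with
    | zero =>
      refine iff_of_true Submodule.mem_top fun u v huv => ?_
      obtain ⟨x, -⟩ := (Graph.toSimpleGraph_adj_iff u v).1 huv
      exact x.elim0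
    | succ q =>
      change boundary G q z = 0 ↔ _
      constructor
      · intro h u v huv
        obtain ⟨x, hx⟩ := (Graph.toSimpleGraph_adj_iff u v).1 huv
        have hcard : (Finset.univ.erase x).card = q := by simp
        have := boundary_apply_of_eq rfl z
          (Simplex.sub (by omega) _ hcard (parallel_erase_aux hx.inc_left)) rfl hx
        rw [h, Finsupp.zero_apply, eq_comm, mul_eq_zero] at this
        exact this.resolve_left (pow_ne_zero _ (by norm_num))
      · intro h
        ext b
        have hb := b.card_edges
        obtain ⟨x, hx⟩ : ∃ x, b.edgesᶜ = {x} := by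
          rw [← Finset.card_eq_one, Finset.card_compl, Fintype.card_fin, hb]
          omega
        have hbx : b.edges = Finset.univ.erase x := by
          rw [← compl_compl b.edges, hx]
          ext t; simp
        obtain ⟨u, v, huv⟩ := (G.edge_mem_iff_exists_isLink x).1 (hE ▸ Set.mem_univ x)
        rw [boundary_apply_of_eq rfl z b hbx huv]
        have h1 := h ⟨u, huv.left_mem⟩ ⟨v, huv.right_mem⟩
          ((Graph.toSimpleGraph_adj_iff _ _).2 ⟨x, huv⟩)
        rw [hL, hL] at h1
        rw [h1]
        simp
  refine ⟨(Submodule.quotEquivOfEqBot _ hbot).trans (L.ofSubmodules _ _ ?_)⟩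
  ext f
  constructor
  · rintro ⟨z, hz, rfl⟩
    exact (hmap z).1 hz
  · intro hf
    refine ⟨L.symm f, (hmap _).2 ?_, L.apply_symm_apply f⟩
    rwa [L.apply_symm_apply]

/-- In dimension `c - 2` the cycles are the functions on the parallel classes, and the homology is
the cokernel of the unsigned incidence matrix. -/
theorem homology_next [G.Loopless] [Finite V] (hE : G.edgeSet = Set.univ) (hq : q + 1 = c) :
    Nonempty (Homology G q ≃ₗ[ℤ]
      (G.toSimpleGraph.edgeSet → ℤ) ⧸ LinearMap.range G.toSimpleGraph.unsignedIncidence) := by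
  classical
  obtain ⟨cl, hsurj, hcl⟩ := exists_edgeClass (G := G) hE
  have hlt : q < c := by omega
  let Φ₀ : (G.toSimpleGraph.edgeSet → ℤ) →ₗ[ℤ] (Simplex G q → ℤ) :=
    { toFun := fun k a => ∑ x ∈ a.edgesᶜ, (-1) ^ (x : ℕ) * k (cl x)
      map_add' := fun k k' => by
        ext a; simp [mul_add, Finset.sum_add_distrib]
      map_smul' := fun n k => by
        ext a
        simp only [Pi.smul_apply, smul_eq_mul, RingHom.id_apply, Finset.mul_sum]
        exact Finset.sum_congr rfl fun x _ => by ring }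
  let Φ : (G.toSimpleGraph.edgeSet → ℤ) →ₗ[ℤ] (Simplex G q →₀ ℤ) :=
    (Finsupp.linearEquivFunOnFinite ℤ ℤ _).symm.toLinearMap.comp Φ₀
  -- the simplex that omits just the edge `x`
  have hsub : ∀ x, ∃ b : Simplex G q, b.edges = Finset.univ.erase x := by
    intro x
    obtain ⟨u, v, huv⟩ := (G.edge_mem_iff_exists_isLink x).1 (hE ▸ Set.mem_univ x)
    exact ⟨Simplex.sub hlt _ (by simp; omega) (parallel_erase_aux huv.inc_left), rfl⟩
  choose B hB using hsub
  have hBall : ∀ b : Simplex G q, ∃ x, b = B x := by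
    intro b
    obtain ⟨x, hx⟩ : ∃ x, b.edgesᶜ = {x} := by
      rw [← Finset.card_eq_one, Finset.card_compl, Fintype.card_fin, b.card_edges]
      omega
    refine ⟨x, Simplex.ext_of_lt hlt ?_⟩
    rw [hB, ← compl_compl b.edges, hx]
    ext t; simp
  have hΦ : ∀ k x, Φ k (B x) = (-1) ^ (x : ℕ) * k (cl x) := by
    intro k x
    change ∑ y ∈ (B x).edgesᶜ, (-1) ^ (y : ℕ) * k (cl y) = _
    have : (B x).edgesᶜ = {x} := by rw [hB]; ext t; simp
    rw [this, Finset.sum_singleton]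
  have hinj : Function.Injective Φ := by
    rw [injective_iff_map_eq_zero]
    intro k hk
    ext e
    obtain ⟨x, rfl⟩ := hsurj e
    have := hΦ k x
    rw [hk, Finsupp.zero_apply, eq_comm, mul_eq_zero] at this
    exact this.resolve_left (pow_ne_zero _ (by norm_num))
  -- the sign `(-1) ^ x` makes the coefficients of a cycle constant on parallel classes
  have hcyc : ∀ z, z ∈ cycles G q ↔ ∀ x y, cl x = cl y →
      (-1) ^ (x : ℕ) * z (B x) = (-1) ^ (y : ℕ) * z (B y) := by
    intro z
    cases q with
    | zero =>
      -- `c = 1`: there is just one edge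
      refine iff_of_true Submodule.mem_top fun x y _ => ?_
      obtain rfl : x = y := Fin.ext (by have := x.2; have := y.2; omega)
      rfl
    | succ q' =>
      have hlt' : q' + 1 < c := by omega
      have hform : ∀ (b : Simplex G q') (x y : Fin c), x < y → b.edgesᶜ = {x, y} →
          boundary G q' z b = (-1) ^ (x : ℕ) * z (B y) - (-1) ^ (y : ℕ) * z (B x) := by
        intro b x y hxy hb
        have hbe : b.edges = ({x, y} : Finset (Fin c))ᶜ := by rw [← hb, compl_compl]
        have hbx : insert x b.edges = (B y).edges := by
          rw [hB, hbe]
          ext t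
          simp only [Finset.mem_insert, Finset.mem_compl, Finset.mem_singleton, Finset.mem_erase,
            Finset.mem_univ, and_true]
          have := hxy.ne
          by_cases h1 : t = x <;> simp [h1, this]
        have hby : insert y b.edges = (B x).edges := by
          rw [hB, hbe]
          ext t
          simp only [Finset.mem_insert, Finset.mem_compl, Finset.mem_singleton, Finset.mem_erase,
            Finset.mem_univ, and_true]
          have := hxy.ne'
          by_cases h1 : t = y <;> simp [h1, this]
        have hxb : x ∉ b.edges := by rw [hbe]; simp
        have hyb : y ∉ b.edges := by rw [hbe]; simp
        have s1 : below b.edges x = x := by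
          have h1 := below_erase_self Finset.univ y
          have h2 := below_insert hyb x
          rw [if_neg hxy.not_gt, hby, hB, below_erase_self, below_univ] at h2
          omega
        have s2 : below b.edges y + 1 = y := by
          have h2 := below_insert hxb y
          rw [if_pos hxy, hbx, hB, below_erase_self, below_univ] at h2
          omega
        rw [boundary_apply_of_lt hlt', hb, Finset.sum_pair hxy.ne, hbx, hby, coeff_edges hlt',
          coeff_edges hlt', s1, ← s2, pow_succ]
        ring
      have hiff : ∀ x y : Fin c, (-1) ^ (x : ℕ) * z (B y) - (-1) ^ (y : ℕ) * z (B x) = 0 ↔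
          (-1) ^ (x : ℕ) * z (B x) = (-1) ^ (y : ℕ) * z (B y) := by
        intro x y
        have hx := neg_one_pow_mul_self (x : ℕ)
        have hy := neg_one_pow_mul_self (y : ℕ)
        constructor <;> intro h
        · linear_combination (-(-1) ^ (x : ℕ) * (-1) ^ (y : ℕ)) * h -
            (-1) ^ (x : ℕ) * z (B x) * hy + (-1) ^ (y : ℕ) * z (B y) * hx
        · linear_combination (-(-1) ^ (x : ℕ) * (-1) ^ (y : ℕ)) * h +
            (-1) ^ (y : ℕ) * z (B x) * hx - (-1) ^ (x : ℕ) * z (B y) * hy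
      change boundary G q' z = 0 ↔ _
      constructor
      · intro h
        have key : ∀ x y, x < y → cl x = cl y →
            (-1) ^ (x : ℕ) * z (B x) = (-1) ^ (y : ℕ) * z (B y) := by
          intro x y hxy hc
          have hpar : ParallelOutside G ({x, y} : Finset (Fin c))ᶜ := by
            refine parallelOutside_of_cl hcl (x₀ := x) fun t ht => ?_
            rw [Finset.mem_compl, not_not, Finset.mem_insert, Finset.mem_singleton] at ht
            rcases ht with rfl | rfl
            · rfl
            · exact hc.symm
          have hcard : (({x, y} : Finset (Fin c))ᶜ).card = q' := by
            rw [Finset.card_compl, Fintype.card_fin, Finset.card_pair hxy.ne]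
            omega
          have := hform (Simplex.sub (by omega) _ hcard hpar) x y hxy (compl_compl _)
          rw [h, Finsupp.zero_apply] at this
          exact (hiff x y).1 this.symm
        intro x y hc
        rcases lt_trichotomy x y with hxy | rfl | hxy
        · exact key x y hxy hc
        · rfl
        · exact (key y x hxy hc.symm).symm
      · intro h
        ext b
        have hbpar := b.parallelOutside (by omega)
        obtain ⟨x, y, hxy, hb⟩ : ∃ x y, x ≠ y ∧ b.edgesᶜ = {x, y} := by
          rw [← Finset.card_eq_two, Finset.card_compl, Fintype.card_fin, b.card_edges]
          omega
        wlog hlt : x < y generalizing x y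
        · exact this y x hxy.symm (by rw [hb, Finset.pair_comm])
            (lt_of_le_of_ne (not_lt.1 hlt) hxy.symm)
        rw [hform b x y hlt hb, Finsupp.zero_apply, hiff]
        refine h x y (hbpar.cl_eq hcl ?_ ?_)
        · rw [← Finset.mem_compl, hb]; simp
        · rw [← Finset.mem_compl, hb]; simp
  have hmem : ∀ k, Φ k ∈ cycles G q := by
    intro k
    rw [hcyc]
    intro x y hxy
    rw [hΦ, hΦ, ← mul_assoc, ← mul_assoc, neg_one_pow_mul_self, neg_one_pow_mul_self, hxy]
  let Ψ : (G.toSimpleGraph.edgeSet → ℤ) ≃ₗ[ℤ] cycles G q :=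
    LinearEquiv.ofBijective (Φ.codRestrict _ hmem) (by
      constructor
      · intro k k' h
        exact hinj (congrArg Subtype.val h)
      · rintro ⟨z, hz⟩
        rw [hcyc] at hz
        let σ := Function.surjInv hsurj
        refine ⟨fun e => (-1) ^ (σ e : ℕ) * z (B (σ e)), Subtype.ext (Finsupp.ext fun b => ?_)⟩
        obtain ⟨x, rfl⟩ := hBall b
        change Φ _ (B x) = z (B x)
        rw [hΦ, hz _ x (Function.surjInv_eq hsurj _), ← mul_assoc, neg_one_pow_mul_self, one_mul])
  have hbd : ∀ y : Simplex G (q + 1) →₀ ℤ, boundary G q y =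
      Φ (G.toSimpleGraph.unsignedIncidence fun T => y (Simplex.top hq T.1 T.2)) := by
    intro y
    ext b
    obtain ⟨x, rfl⟩ := hBall b
    obtain ⟨u, v, huv⟩ := (G.edge_mem_iff_exists_isLink x).1 (hE ▸ Set.mem_univ x)
    rw [boundary_apply_of_eq hq y (B x) (hB x) huv, hΦ]
    congr 1
    have h1 := (hcl x ⟨u, huv.left_mem⟩ ⟨v, huv.right_mem⟩).1 huv
    change _ = SimpleGraph.endSum _ (cl x).1
    rw [h1]
    rfl
  refine ⟨(Submodule.Quotient.equiv _ _ Ψ ?_).symm⟩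
  ext ⟨z, hz⟩
  constructor
  · rintro ⟨_, ⟨f, rfl⟩, hf⟩
    refine ⟨Finsupp.equivFunOnFinite.symm fun a => match a with
      | Simplex.top _ T hT => f ⟨T, hT⟩
      | Simplex.sub _ _ _ _ => 0, ?_⟩
    rw [hbd]
    exact congrArg Subtype.val hf
  · rintro ⟨y, hy⟩
    refine ⟨_, ⟨_, rfl⟩, Subtype.ext ((hbd y).symm.trans hy)⟩

end PartialPresimplicial

/-! ### Almost-extreme enhanced states -/

namespace LinkDiagram

variable {D : LinkDiagram}

theorem exists_eq_stateOf (s : D.State) : ∃ S, s = D.stateOf S := by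
  refine ⟨Finset.univ.filter fun x => s x = Label.B, funext fun x => ?_⟩
  cases h : s x <;> simp [stateOf, h]

theorem stateOf_eq_A {S : Finset (Fin D.c)} {x : Fin D.c} : D.stateOf S x = Label.A ↔ x ∉ S := by
  by_cases h : x ∈ S <;> simp [stateOf, h]

theorem stateOf_eq_B {S : Finset (Fin D.c)} {x : Fin D.c} : D.stateOf S x = Label.B ↔ x ∈ S := by
  by_cases h : x ∈ S <;> simp [stateOf, h]

theorem sigma_stateOf (S : Finset (Fin D.c)) :
    sigma (D.stateOf S) = (D.c : ℤ) - 2 * S.card := by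
  have h1 : (Finset.univ.filter fun x => D.stateOf S x = Label.A) = Sᶜ := by
    ext x; simp [stateOf_eq_A]
  have h2 : (Finset.univ.filter fun x => D.stateOf S x = Label.B) = S := by
    ext x; simp [stateOf_eq_B]
  have h3 := S.card_add_card_compl
  rw [Fintype.card_fin] at h3
  rw [sigma, h1, h2]
  omega

open Classical in
/-- The number of negative circles of an enhanced state. -/
noncomputable def numNeg (S : D.EnhancedState) : ℕ :=
  (Finset.univ.filter fun C : Circle S.1 => S.2 C = -1).card

theorem tau_eq (S : D.EnhancedState) :
    tau S = (Nat.card (Circle S.1) : ℤ) - 2 * numNeg S := by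
  classical
  have h : ∀ C : Circle S.1, ((S.2 C : ℤˣ) : ℤ) = 1 - 2 * if S.2 C = -1 then 1 else 0 := by
    intro C
    rcases Int.units_eq_one_or (S.2 C) with h | h <;> rw [h] <;> decide
  rw [tau, Finset.sum_congr rfl fun C _ => h C, Finset.sum_sub_distrib, ← Finset.mul_sum,
    numNeg, Finset.sum_boole, Nat.card_eq_fintype_card]
  simp

theorem jIndex_stateOf (S : Finset (Fin D.c)) (σ : Circle (D.stateOf S) → ℤˣ) :
    jIndex (⟨D.stateOf S, σ⟩ : D.EnhancedState) =
      (D.c : ℤ) - 2 * S.card + 2 * Nat.card (Circle (D.stateOf S)) -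
        4 * numNeg (⟨D.stateOf S, σ⟩ : D.EnhancedState) := by
  rw [jIndex, tau_eq, sigma_stateOf]
  ring

theorem card_circle_stateOf_empty : Nat.card (Circle (D.stateOf ∅)) = D.numCirclesA := by
  rw [stateOf_empty]; rfl

theorem AAdequate.ne (hA : D.AAdequate) (x : Fin D.c) :
    circleOf D.stateA (x, 0) ≠ circleOf D.stateA (x, 2) := by
  intro h
  refine hA.not_isLoopAt x (circleOf D.stateA (x, 0)) ?_
  change s(_, _) = s(_, _)
  rw [← h]

/-- The first change of a label joins two circles, and each further one adds at most one circle. -/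
theorem card_circle_le (hA : D.AAdequate) {S : Finset (Fin D.c)} (hS : S.Nonempty) :
    Nat.card (Circle (D.stateOf S)) + 2 ≤ D.numCirclesA + S.card := by
  obtain ⟨y, hy⟩ := hS
  by_cases hpar : ∀ z ∈ S, chord z = chord y
  · exact (card_circle_of_parallel hA.ne y ⟨y, hy⟩ hpar).1.le
  · push Not at hpar
    obtain ⟨z, hz, hzy⟩ := hpar
    have := card_circle_of_not_parallel hA.ne hz hy hzy
    omega

theorem jIndex_le (hA : D.AAdequate) (S : D.EnhancedState) :
    jIndex S ≤ (D.c : ℤ) + 2 * D.numCirclesA := by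
  obtain ⟨s, σ⟩ := S
  obtain ⟨S, rfl⟩ := exists_eq_stateOf s
  rw [jIndex_stateOf]
  rcases S.eq_empty_or_nonempty with rfl | hS
  · rw [card_circle_stateOf_empty, Finset.card_empty]
    omega
  · have := card_circle_le hA hS
    omega

theorem jMax_eq (hA : D.AAdequate) : D.jMax = (D.c : ℤ) + 2 * D.numCirclesA := by
  classical
  have hne : Nonempty D.EnhancedState := ⟨⟨D.stateOf ∅, fun _ => 1⟩⟩
  refine le_antisymm (ciSup_le (jIndex_le hA)) ?_
  have h := le_ciSup (f := fun S : D.EnhancedState => jIndex S) (Set.finite_range _).bddAbove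
    ⟨D.stateOf ∅, fun _ => 1⟩
  refine le_trans (le_of_eq ?_) h
  have h0 : numNeg (⟨D.stateOf ∅, fun _ => 1⟩ : D.EnhancedState) = 0 := by
    rw [numNeg, Finset.card_eq_zero, Finset.filter_eq_empty_iff]
    intro C _
    change ¬ (1 : ℤˣ) = -1
    decide
  rw [jIndex_stateOf, h0, card_circle_stateOf_empty, Finset.card_empty]
  simp

theorem jAlmax_eq (hA : D.AAdequate) : D.jAlmax = (D.c : ℤ) + 2 * D.numCirclesA - 4 := by
  rw [jAlmax, jMax_eq hA]

open PartialPresimplicial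

theorem parallelOutside_iff {w : Finset (Fin D.c)} :
    ParallelOutside D.graphA w ↔ ∃ p, ∀ x ∉ w, chord x = p := by
  constructor
  · rintro ⟨u, v, h⟩
    exact ⟨s(u, v), fun x hx => Eq.symm (a := s(u, v)) (h x hx)⟩
  · rintro ⟨p, h⟩
    induction p using Sym2.ind with
    | _ u v => exact ⟨u, v, fun x hx => Eq.symm (a := chord x) (h x hx)⟩

theorem graphA_inc_iff {x : Fin D.c} {T : Circle D.stateA} :
    D.graphA.Inc x T ↔ T = circleOf D.stateA (x, 0) ∨ T = circleOf D.stateA (x, 2) := by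
  constructor
  · rintro ⟨y, hy⟩
    rcases Sym2.eq_iff.1 hy with ⟨h, -⟩ | ⟨h, -⟩
    · exact Or.inl h
    · exact Or.inr h
  · rintro (rfl | rfl)
    · exact ⟨_, rfl⟩
    · exact ⟨_, Sym2.eq_swap⟩

open Classical in
/-- The almost-extreme enhanced state of a simplex.  A vertex of `G_A(D)` becomes the negative
circle of `s_A`; a set of edges becomes the set of `A`-labelled crossings, with positive
circles. -/
noncomputable def enhanced {q : ℕ} : Simplex D.graphA q → D.EnhancedState
  | Simplex.top _ T _ => ⟨D.stateA, fun C => if C = T then -1 else 1⟩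
  | Simplex.sub _ w _ _ => ⟨D.stateOf wᶜ, fun _ => 1⟩

theorem enhanced_fst {q : ℕ} (a : Simplex D.graphA q) :
    (enhanced a).1 = D.stateOf a.edgesᶜ := by
  cases a with
  | top hq T hT =>
    rw [show (Simplex.top hq T hT : Simplex D.graphA q).edges = Finset.univ from rfl,
      Finset.compl_univ, stateOf_empty]
    rfl
  | sub hq w hw hpar => rfl

theorem iIndex_enhanced {q : ℕ} (a : Simplex D.graphA q) :
    iIndex (enhanced a) = 2 * q - D.c := by
  have h := a.edges.card_add_card_compl
  rw [Fintype.card_fin, a.card_edges] at h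
  rw [iIndex, enhanced_fst, sigma_stateOf]
  omega

theorem jIndex_enhanced (hA : D.AAdequate) {q : ℕ} (a : Simplex D.graphA q) :
    jIndex (enhanced a) = (D.c : ℤ) + 2 * D.numCirclesA - 4 := by
  classical
  cases a with
  | top hq T hT =>
    have h1 : numNeg (enhanced (Simplex.top hq T hT : Simplex D.graphA q)) = 1 := by
      rw [numNeg, Finset.card_eq_one]
      refine ⟨T, Finset.ext fun (C : Circle D.stateA) =>
        (Finset.mem_filter.trans ?_).trans Finset.mem_singleton.symm⟩
      have hC : (if C = T then (-1 : ℤˣ) else 1) = -1 ↔ C = T := by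
        split_ifs with h
        · simp [h]
        · simp only [h, iff_false]; decide
      exact ⟨fun h => hC.1 h.2, fun h => ⟨Finset.mem_univ _, hC.2 h⟩⟩
    have h2 : sigma D.stateA = D.c := by
      rw [← stateOf_empty, sigma_stateOf]; simp
    rw [jIndex, tau_eq, h1]
    change sigma D.stateA + 2 * ((D.numCirclesA : ℤ) - _) = _
    rw [h2]
    push_cast
    ring
  | sub hq w hw hpar =>
    have h0 : numNeg (enhanced (Simplex.sub hq w hw hpar : Simplex D.graphA q)) = 0 := by
      rw [numNeg, Finset.card_eq_zero, Finset.filter_eq_empty_iff]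
      intro C _
      change ¬ (1 : ℤˣ) = -1
      decide
    obtain ⟨p, hp⟩ := parallelOutside_iff.1 hpar
    have hne : wᶜ.Nonempty := by
      rw [← Finset.card_pos, Finset.card_compl, Fintype.card_fin]
      omega
    obtain ⟨y, hy⟩ := hne
    have h1 := (card_circle_of_parallel hA.ne y ⟨y, hy⟩ fun z hz =>
      (hp z (Finset.mem_compl.1 hz)).trans (hp y (Finset.mem_compl.1 hy)).symm).1
    rw [jIndex, tau_eq, h0]
    change sigma (D.stateOf wᶜ) + 2 * ((Nat.card (Circle (D.stateOf wᶜ)) : ℤ) - _) = _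
    rw [sigma_stateOf]
    push_cast
    omega

/-- Every almost-extreme enhanced state comes from a simplex. -/
theorem exists_enhanced_eq (hA : D.AAdequate) {q : ℕ} (S : D.EnhancedState)
    (hi : iIndex S = 2 * q - D.c) (hj : jIndex S = (D.c : ℤ) + 2 * D.numCirclesA - 4) :
    ∃ a : Simplex D.graphA q, enhanced a = S := by
  classical
  obtain ⟨s, σ⟩ := S
  obtain ⟨S, rfl⟩ := exists_eq_stateOf s
  have hcard := S.card_add_card_compl
  rw [Fintype.card_fin] at hcard
  change sigma (D.stateOf S) = _ at hi
  rw [sigma_stateOf] at hi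
  rw [jIndex_stateOf] at hj
  rcases S.eq_empty_or_nonempty with rfl | hS
  · rw [card_circle_stateOf_empty, Finset.card_empty] at hj
    rw [Finset.card_empty] at hi
    have hN : numNeg (⟨D.stateOf ∅, σ⟩ : D.EnhancedState) = 1 := by push_cast at hj; omega
    clear hj
    revert σ
    rw [stateOf_empty]
    intro σ hN
    obtain ⟨T, hT⟩ := Finset.card_eq_one.1 hN
    have hσ : ∀ C, σ C = -1 ↔ C = T := fun C => by
      have := Finset.ext_iff.1 hT C
      simpa using this
    refine ⟨Simplex.top (by push_cast at hi; omega) T (Set.mem_univ _),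
      Sigma.ext rfl (heq_of_eq (funext fun (C : Circle D.stateA) => ?_))⟩
    change (if C = T then (-1 : ℤˣ) else 1) = σ C
    split_ifs with h
    · exact ((hσ C).2 h).symm
    · exact ((Int.units_eq_one_or (σ C)).resolve_right fun h' => h ((hσ C).1 h')).symm
  · have hle := card_circle_le hA hS
    have hN : numNeg (⟨D.stateOf S, σ⟩ : D.EnhancedState) = 0 := by omega
    have hpar : ∀ y ∈ S, ∀ z ∈ S, chord y = chord z := by
      intro y hy z hz
      by_contra hne
      have := card_circle_of_not_parallel hA.ne hy hz hne
      omega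
    obtain ⟨y, hy⟩ := hS
    have hpos : 0 < S.card := Finset.card_pos.2 ⟨y, hy⟩
    have hpar' : ParallelOutside D.graphA Sᶜ := parallelOutside_iff.2
      ⟨chord y, fun x hx => hpar x (by simpa using hx) y hy⟩
    obtain ⟨w, rfl⟩ : ∃ w, S = wᶜ := ⟨Sᶜ, (compl_compl S).symm⟩
    rw [compl_compl] at hpar' hcard
    refine ⟨Simplex.sub (by omega) w (by omega) hpar',
      Sigma.ext rfl (heq_of_eq (funext fun C => ?_))⟩
    rw [numNeg, Finset.card_eq_zero, Finset.filter_eq_empty_iff] at hN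
    exact ((Int.units_eq_one_or (σ C)).resolve_right (hN (Finset.mem_univ C))).symm

theorem enhanced_injective {q : ℕ} :
    Function.Injective (enhanced : Simplex D.graphA q → D.EnhancedState) := by
  classical
  intro a b h
  refine Simplex.ext_of_edges ?_ ?_
  · have h1 := congrArg Sigma.fst h
    rw [enhanced_fst, enhanced_fst] at h1
    ext x
    have h2 := congrFun h1 x
    rw [← not_iff_not, ← Finset.mem_compl, ← Finset.mem_compl, ← stateOf_eq_B, h2, stateOf_eq_B]
  · cases a with
    | sub hq w hw hpar => rw [Simplex.vertex?_eq_none hq, Simplex.vertex?_eq_none hq]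
    | top hq T hT =>
      cases b with
      | sub hq' w hw hpar => omega
      | top hq' T' hT' =>
        have h1 := congrFun (eq_of_heq (Sigma.ext_iff.1 h).2) T
        change (if T = T then (-1 : ℤˣ) else 1) = if T = T' then (-1 : ℤˣ) else 1 at h1
        rw [if_pos rfl] at h1
        have : T = T' := by
          by_contra hne
          rw [if_neg hne] at h1
          revert h1
          decide
        rw [this]

theorem adjacentAt_enhanced_iff (hA : D.AAdequate) {q : ℕ} (a : Simplex D.graphA (q + 1))
    (b : Simplex D.graphA q) (x : Fin D.c) :
    AdjacentAt (enhanced a) (enhanced b) x ↔ IsFaceAt x a b := by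
  classical
  have hq : q < D.c := by have := a.le_card; omega
  have hi : iIndex (enhanced b) = iIndex (enhanced a) - 2 := by
    rw [iIndex_enhanced, iIndex_enhanced]; push_cast; ring
  have hj : jIndex (enhanced b) = jIndex (enhanced a) := by
    rw [jIndex_enhanced hA, jIndex_enhanced hA]
  have hlabels : ((enhanced a).1 x = Label.A ∧ (enhanced b).1 x = Label.B ∧
      ∀ y, y ≠ x → (enhanced a).1 y = (enhanced b).1 y) ↔
      x ∈ a.edges ∧ b.edges = a.edges.erase x := by
    rw [enhanced_fst, enhanced_fst, stateOf_eq_A, stateOf_eq_B, Finset.mem_compl, not_not,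
      Finset.mem_compl]
    refine and_congr_right fun hx => ?_
    have hy : ∀ y, D.stateOf a.edgesᶜ y = D.stateOf b.edgesᶜ y ↔ (y ∈ a.edges ↔ y ∈ b.edges) := by
      intro y
      by_cases h1 : y ∈ a.edges <;> by_cases h2 : y ∈ b.edges <;> simp [stateOf, h1, h2]
    simp only [hy]
    constructor
    · rintro ⟨h1, h2⟩
      ext y
      rw [Finset.mem_erase]
      by_cases hyx : y = x
      · subst hyx
        simp [h1]
      · rw [← h2 y hyx]
        simp [hyx]
    · intro h
      rw [h]
      refine ⟨Finset.notMem_erase _ _, fun y hyx => ?_⟩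
      simp [hyx]
  have hsigns : ((∀ d : Dart D.c,
      (∀ k, circleOf (enhanced a).1 (x, k) ≠ circleOf (enhanced a).1 d) →
        (enhanced a).2 (circleOf (enhanced a).1 d) = (enhanced b).2 (circleOf (enhanced b).1 d)) ∧
      ∀ f : Fin D.freeCircles, (enhanced a).2 (Sum.inr f) = (enhanced b).2 (Sum.inr f)) ↔
      ∀ T, a.vertex? = some T → D.graphA.Inc x T := by
    cases b with
    | top hq' T' hT' => omega
    | sub hq' w' hw' hpar' =>
      cases a with
      | sub hq w hw hpar =>
        refine iff_of_true ⟨fun _ _ => rfl, fun _ => rfl⟩ fun T hT => ?_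
        cases hT
      | top hq T hT =>
        have hval : ∀ C : Circle D.stateA, (if C = T then (-1 : ℤˣ) else 1) = 1 ↔ C ≠ T := by
          intro C
          split_ifs with h
          · simp only [h, ne_eq, not_true_eq_false, iff_false]; decide
          · simp [h]
        change ((∀ d, (∀ k, circleOf D.stateA (x, k) ≠ circleOf D.stateA d) →
          (if circleOf D.stateA d = T then (-1 : ℤˣ) else 1) = 1) ∧
          ∀ f : Fin D.freeCircles, (if (Sum.inr f : Circle D.stateA) = T then (-1 : ℤˣ) else 1) = 1)
          ↔ _
        simp only [hval]
        have hinc : (∀ T', (Simplex.top hq T hT : Simplex D.graphA (q + 1)).vertex? = some T' →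
            D.graphA.Inc x T') ↔ D.graphA.Inc x T :=
          ⟨fun h => h T rfl, fun h T' hT' => Option.some_injective _ hT' ▸ h⟩
        rw [hinc, graphA_inc_iff]
        obtain ⟨e1, e3⟩ := circleOf_stateA x
        constructor
        · rintro ⟨h1, h2⟩
          by_contra hne
          push Not at hne
          rcases T with T | f
          · induction T using Quot.ind with
            | mk d =>
              refine h1 d (fun k => ?_) rfl
              have h0 := hne.1.symm
              have h2 := hne.2.symm
              fin_cases k
              · exact h0
              · exact fun h => h0 (e1.symm.trans h)
              · exact h2
              · exact fun h => h2 (e3.symm.trans h)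
          · exact h2 f rfl
        · rintro (rfl | rfl)
          · exact ⟨fun d h => (h 0).symm, fun f h => by cases h⟩
          · exact ⟨fun d h => (h 2).symm, fun f h => by cases h⟩
  constructor
  · rintro ⟨-, -, l1, l2, l3, s1, s2⟩
    obtain ⟨h1, h2⟩ := hlabels.1 ⟨l1, l2, l3⟩
    exact ⟨h1, h2, hsigns.1 ⟨s1, s2⟩⟩
  · rintro ⟨h1, h2, h4⟩
    obtain ⟨l1, l2, l3⟩ := hlabels.2 ⟨h1, h2⟩
    obtain ⟨s1, s2⟩ := hsigns.2 h4
    exact ⟨hi, hj, l1, l2, l3, s1, s2⟩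

/-- The sign by which the basis element of a simplex has to be changed in order to turn the signs
of the boundary, which count omitted edges from the left, into those of Khovanov homology, which
count `B`-labelled crossings from the right. -/
noncomputable def simplexSign {q : ℕ} (a : Simplex D.graphA q) : ℤˣ :=
  (-1) ^ (∑ y ∈ a.edges, (y : ℕ) + ∑ t ∈ Finset.range q, (D.c + t + 1))

theorem simplexSign_mul {q : ℕ} {a : Simplex D.graphA (q + 1)} {b : Simplex D.graphA q}
    {x : Fin D.c} (h : IsFaceAt x a b) :
    (simplexSign a : ℤ) *
        (-1) ^ (Finset.univ.filter fun y => x < y ∧ (enhanced a).1 y = Label.B).card =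
      simplexSign b * (-1) ^ below a.edges x := by
  classical
  set k := (Finset.univ.filter fun y => x < y ∧ (enhanced a).1 y = Label.B).card with hk
  have h1 : ∑ y ∈ a.edges, (y : ℕ) = x + ∑ y ∈ b.edges, (y : ℕ) := by
    rw [h.2.1, Finset.add_sum_erase _ _ h.1]
  have h2 : below a.edges x + (a.edgesᶜ.filter (· < x)).card = x := by
    have := Finset.card_union_of_disjoint (s := a.edges.filter (· < x))
      (t := a.edgesᶜ.filter (· < x)) (by
        refine Finset.disjoint_filter_filter ?_
        exact disjoint_compl_right)
    rw [← Finset.filter_union, Finset.union_compl] at this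
    rw [below, ← this]
    exact below_univ x
  have h3 : k + (a.edgesᶜ.filter (· < x)).card + (q + 1) = D.c := by
    have hc := a.edges.card_add_card_compl
    rw [Fintype.card_fin, a.card_edges] at hc
    have h4 := Finset.card_filter_add_card_filter_not (s := a.edgesᶜ) (fun y => y < x)
    have h5 : a.edgesᶜ.filter (fun y => ¬ y < x) =
        Finset.univ.filter fun y => x < y ∧ (enhanced a).1 y = Label.B := by
      ext y
      rw [enhanced_fst, Finset.mem_filter, Finset.mem_filter, stateOf_eq_B]
      simp only [Finset.mem_univ, true_and]
      constructor
      · rintro ⟨hy, hxy⟩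
        refine ⟨lt_of_le_of_ne (not_lt.1 hxy) ?_, hy⟩
        rintro rfl
        exact Finset.mem_compl.1 hy h.1
      · rintro ⟨hxy, hy⟩
        exact ⟨hy, hxy.not_gt⟩
    rw [h5] at h4
    omega
  have hpar : (∑ y ∈ a.edges, (y : ℕ) + ∑ t ∈ Finset.range (q + 1), (D.c + t + 1) + k) % 2 =
      (∑ y ∈ b.edges, (y : ℕ) + ∑ t ∈ Finset.range q, (D.c + t + 1) + below a.edges x) % 2 := by
    rw [h1, Finset.sum_range_succ]
    omega
  simp only [simplexSign, Units.val_pow_eq_pow_val, Units.val_neg, Units.val_one]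
  rw [← pow_add, ← pow_add]
  exact neg_one_pow_congr (by rw [Nat.even_iff, Nat.even_iff, hpar])

end LinkDiagram

/-! ### The comparison with Khovanov homology -/

namespace LinkDiagram

open PartialPresimplicial

variable {D : LinkDiagram}

/-- The bijection between the simplices and the almost-extreme enhanced states. -/
noncomputable def simplexEquiv (hA : D.AAdequate) {q : ℕ} {i : ℤ} (hi : i = 2 * q - D.c) :
    Simplex D.graphA q ≃ D.Generator i ((D.c : ℤ) + 2 * D.numCirclesA - 4) :=
  Equiv.ofBijective
    (fun a => ⟨enhanced a, (iIndex_enhanced a).trans hi.symm, jIndex_enhanced hA a⟩)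
    ⟨fun _ _ h => enhanced_injective (congrArg Subtype.val h), fun S => by
      obtain ⟨a, ha⟩ := exists_enhanced_eq (q := q) hA S.1 (S.2.1.trans hi) S.2.2
      exact ⟨a, Subtype.ext ha⟩⟩

/-- The chain isomorphism: the bijection between the bases, with the signs `simplexSign`. -/
noncomputable def chainEquiv (hA : D.AAdequate) {q : ℕ} {i : ℤ} (hi : i = 2 * q - D.c) :
    (Simplex D.graphA q →₀ ℤ) ≃ₗ[ℤ] D.Chain i ((D.c : ℤ) + 2 * D.numCirclesA - 4) :=
  (Finsupp.linearEquivFunOnFinite ℤ ℤ _).trans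
    ((LinearEquiv.piCongrRight fun a => LinearEquiv.smulOfUnit (simplexSign a)).trans
      ((Finsupp.linearEquivFunOnFinite ℤ ℤ _).symm.trans
        (Finsupp.domLCongr (simplexEquiv hA hi))))

theorem chainEquiv_apply (hA : D.AAdequate) {q : ℕ} {i : ℤ} (hi : i = 2 * q - D.c)
    (z : Simplex D.graphA q →₀ ℤ) (a : Simplex D.graphA q) :
    chainEquiv hA hi z (simplexEquiv hA hi a) = simplexSign a * z a := by
  simp only [chainEquiv, LinearEquiv.trans_apply, Finsupp.domLCongr_apply,
    Finsupp.domCongr_apply, Finsupp.equivMapDomain_apply, Equiv.symm_apply_apply]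
  rfl

theorem chainEquiv_single (hA : D.AAdequate) {q : ℕ} {i : ℤ} (hi : i = 2 * q - D.c)
    (a : Simplex D.graphA q) (n : ℤ) :
    chainEquiv hA hi (Finsupp.single a n) =
      Finsupp.single (simplexEquiv hA hi a) (simplexSign a * n) := by
  classical
  ext T
  obtain ⟨b, rfl⟩ := (simplexEquiv hA hi).surjective T
  rw [chainEquiv_apply, Finsupp.single_apply, Finsupp.single_apply]
  simp only [EmbeddingLike.apply_eq_iff_eq]
  split_ifs with h
  · rw [h]
  · simp

theorem differential_single_apply {i i' j : ℤ} (S : D.Generator i j) (n : ℤ)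
    (T : D.Generator i' j) :
    D.differential i i' j (Finsupp.single S n) T = n * incidence S.1 T.1 := by
  classical
  rw [differential, Finsupp.lift_apply, Finsupp.sum_single_index (by simp), Finsupp.smul_apply,
    Finsupp.finsetSum_apply, smul_eq_mul]
  congr 1
  rw [Finset.sum_eq_single T]
  · simp
  · intro T' _ h
    exact Finsupp.single_eq_of_ne h.symm
  · simp

theorem incidence_enhanced (hA : D.AAdequate) {q : ℕ} (a : Simplex D.graphA (q + 1))
    (b : Simplex D.graphA q) :
    (simplexSign a : ℤ) * incidence (enhanced a) (enhanced b) =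
      simplexSign b * boundary D.graphA q (Finsupp.single a 1) b := by
  classical
  rw [incidence, boundary_single_apply, Finset.mul_sum, Finset.mul_sum]
  refine Finset.sum_congr rfl fun x _ => ?_
  by_cases h : IsFaceAt x a b
  · rw [if_pos ((adjacentAt_enhanced_iff hA a b x).2 h), if_pos h, ← simplexSign_mul h]
  · rw [if_neg (fun h' => h ((adjacentAt_enhanced_iff hA a b x).1 h')), if_neg h, mul_zero,
      mul_zero]

theorem differential_chainEquiv (hA : D.AAdequate) {q : ℕ} {i i' : ℤ}
    (hi : i = 2 * (q + 1 : ℕ) - D.c) (hi' : i' = 2 * q - D.c)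
    (z : Simplex D.graphA (q + 1) →₀ ℤ) :
    D.differential i i' _ (chainEquiv hA hi z) = chainEquiv hA hi' (boundary D.graphA q z) := by
  induction z using Finsupp.induction_linear with
  | zero => simp
  | add z z' hz hz' => simp only [map_add, hz, hz']
  | single a n =>
    ext T
    obtain ⟨b, rfl⟩ := (simplexEquiv hA hi').surjective T
    have h : Finsupp.single a n = n • Finsupp.single a (1 : ℤ) := by simp
    rw [chainEquiv_single, differential_single_apply, chainEquiv_apply, h, map_smul,
      Finsupp.smul_apply, smul_eq_mul]
    have := incidence_enhanced hA a b
    change simplexSign a * n * incidence (enhanced a) (enhanced b) = _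
    linear_combination n * this

/-- The almost-extreme Khovanov homology is the homology of the partial presimplicial set. -/
theorem homologyEquiv (hA : D.AAdequate) {q : ℕ} {i : ℤ} (hi : i = 2 * q - D.c) :
    Nonempty (D.Homology i ((D.c : ℤ) + 2 * D.numCirclesA - 4) ≃ₗ[ℤ]
      PartialPresimplicial.Homology D.graphA q) := by
  have hi2 : i + 2 = 2 * (q + 1 : ℕ) - D.c := by rw [hi]; push_cast; ring
  have hcyc : ∀ z, z ∈ cycles D.graphA q ↔
      chainEquiv hA hi z ∈ LinearMap.ker (D.differential i (i - 2) _) := by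
    intro z
    cases q with
    | zero =>
      refine iff_of_true Submodule.mem_top (LinearMap.mem_ker.2 ?_)
      ext ⟨T, hT, -⟩
      -- there is no generator with more than `c` crossings labelled `B`
      obtain ⟨S, hS⟩ := exists_eq_stateOf T.1
      rw [iIndex, hS, sigma_stateOf, hi] at hT
      have := S.card_le_univ
      rw [Fintype.card_fin] at this
      push_cast at hT
      omega
    | succ q =>
      rw [LinearMap.mem_ker, differential_chainEquiv hA hi
        (show i - 2 = 2 * q - D.c by rw [hi]; push_cast; ring), LinearEquiv.map_eq_zero_iff]
      rfl
  let e : cycles D.graphA q ≃ₗ[ℤ] LinearMap.ker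
      (D.differential i (i - 2) ((D.c : ℤ) + 2 * D.numCirclesA - 4)) :=
    (chainEquiv hA hi).ofSubmodules _ _ (by
      ext y
      constructor
      · rintro ⟨z, hz, rfl⟩
        exact (hcyc z).1 hz
      · intro hy
        refine ⟨(chainEquiv hA hi).symm y, (hcyc _).2 ?_, LinearEquiv.apply_symm_apply _ y⟩
        rwa [LinearEquiv.apply_symm_apply])
  refine ⟨(Submodule.Quotient.equiv _ _ e ?_).symm⟩
  ext ⟨y, hy⟩
  constructor
  · rintro ⟨⟨_, hz⟩, ⟨z, rfl⟩, h⟩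
    refine ⟨chainEquiv hA hi2 z, ?_⟩
    rw [differential_chainEquiv hA hi2 hi]
    exact congrArg Subtype.val h
  · rintro ⟨t, ht⟩
    obtain ⟨z, rfl⟩ := (chainEquiv hA hi2).surjective t
    rw [differential_chainEquiv hA hi2 hi] at ht
    change chainEquiv hA hi (boundary D.graphA q z) = y at ht
    refine ⟨⟨boundary D.graphA q z, (hcyc _).2 (ht ▸ hy)⟩, ⟨z, rfl⟩, Subtype.ext ht⟩

theorem subsingleton_homology_of_forall_ne {i : ℤ} (hi : ∀ q : ℕ, i ≠ 2 * q - D.c) (j : ℤ) :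
    Subsingleton (D.Homology i j) := by
  have : IsEmpty (D.Generator i j) := by
    refine ⟨fun ⟨T, hT, _⟩ => ?_⟩
    obtain ⟨S, hS⟩ := exists_eq_stateOf T.1
    rw [iIndex, hS, sigma_stateOf] at hT
    have := S.card_le_univ
    rw [Fintype.card_fin] at this
    exact hi (D.c - S.card) (by omega)
  infer_instance

theorem subsingleton_homology_of_ne (hA : D.AAdequate) {i : ℤ}
    (h₁ : i ≠ D.c) (h₂ : i ≠ D.c - 2) :
    Subsingleton (D.Homology i ((D.c : ℤ) + 2 * D.numCirclesA - 4)) := by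
  have : D.graphA.Loopless := hA
  by_cases hi : ∃ q : ℕ, i = 2 * q - D.c
  · obtain ⟨q, hq⟩ := hi
    obtain ⟨e⟩ := homologyEquiv hA hq
    have : Subsingleton (PartialPresimplicial.Homology D.graphA q) := by
      by_cases hlt : q + 1 < D.c
      · exact PartialPresimplicial.subsingleton_homology_of_lt rfl hlt
      · exact PartialPresimplicial.subsingleton_homology_of_gt (by omega)
    exact e.toEquiv.subsingleton
  · push Not at hi
    exact subsingleton_homology_of_forall_ne hi _

theorem connected_toSimpleGraph (hconn : D.Connected) (hA : D.AAdequate) :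
    D.graphA.toSimpleGraph.Connected := by
  have : D.graphA.Loopless := hA
  obtain ⟨hsub, hne⟩ := Nat.card_eq_one_iff_unique.1 hconn
  have hV : ∀ C : Circle D.stateA, C ∈ D.graphA.vertexSet := fun C => Set.mem_univ C
  let comp : Dart D.c → D.graphA.toSimpleGraph.ConnectedComponent := fun d =>
    D.graphA.toSimpleGraph.connectedComponentMk ⟨circleOf D.stateA d, hV _⟩
  have hcomp : ∀ d d', circleOf D.stateA d = circleOf D.stateA d' → comp d = comp d' := by
    intro d d' h
    simp only [comp, h]
  have h0 : ∀ x k, comp (x, k) = comp (x, 0) := by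
    intro x k
    obtain ⟨e1, e3⟩ := circleOf_stateA x
    have e2 : comp (x, 2) = comp (x, 0) := by
      refine SimpleGraph.ConnectedComponent.sound (SimpleGraph.Adj.reachable ?_)
      rw [Graph.toSimpleGraph_adj_iff]
      exact ⟨x, Sym2.eq_swap⟩
    fin_cases k
    · rfl
    · exact hcomp _ _ e1
    · exact e2
    · exact (hcomp _ _ e3).trans e2
  have hstep : ∀ d d' : Dart D.c, d' = D.arc d ∨ d'.1 = d.1 → comp d = comp d' := by
    rintro d d' (rfl | h)
    · exact (hcomp _ _ (circleOf_arc _ _)).symm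
    · obtain ⟨x, k⟩ := d
      obtain ⟨x', k'⟩ := d'
      obtain rfl : x' = x := h
      rw [h0 x' k, h0 x' k']
  refine { preconnected := ?_, nonempty := ?_ }
  · rintro ⟨u, hu⟩ ⟨v, hv⟩
    rcases u with u | f <;> rcases v with v | f'
    · induction u using Quot.ind with
      | mk d =>
        induction v using Quot.ind with
        | mk d' =>
          have h1 : (Quot.mk _ d : D.GraphPiece) = Quot.mk _ d' :=
            Sum.inl_injective (β := Fin D.freeCircles) (hsub.elim _ _)
          exact SimpleGraph.ConnectedComponent.exact
            (congrArg (Quot.lift comp hstep) h1 : comp d = comp d')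
    · induction u using Quot.ind with
      | mk d => cases hsub.elim (Sum.inl (Quot.mk _ d) : D.Piece) (Sum.inr f')
    · induction v using Quot.ind with
      | mk d => cases hsub.elim (Sum.inl (Quot.mk _ d) : D.Piece) (Sum.inr f)
    · have h1 : (Sum.inr f : D.Piece) = Sum.inr f' := hsub.elim _ _
      obtain rfl : f = f' := Sum.inr_injective h1
      exact SimpleGraph.Reachable.refl _
  · rcases hne with ⟨p | f⟩
    · induction p using Quot.ind with
      | mk d => exact ⟨⟨circleOf D.stateA d, hV _⟩⟩
    · exact ⟨⟨Sum.inr f, hV _⟩⟩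

end LinkDiagram

theorem exists_coloring_of_isBipartiteGraph {V E : Type*} {G : Graph V E}
    (h : IsBipartiteGraph G) :
    ∃ f : G.vertexSet → Bool, ∀ u v, G.toSimpleGraph.Adj u v → f u ≠ f v := by
  obtain ⟨f, hf⟩ := h
  refine ⟨fun v => f v, fun u v huv => ?_⟩
  obtain ⟨-, e, he⟩ := huv
  exact hf e _ _ he

theorem not_exists_coloring_of_hasOddCycle {V E : Type*} {G : Graph V E} [G.Loopless]
    (h : HasOddCycle G) :
    ¬ ∃ f : G.vertexSet → Bool, ∀ u v, G.toSimpleGraph.Adj u v → f u ≠ f v := by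
  rintro ⟨f, hf⟩
  obtain ⟨n, hn, v, e, -, -, hlink⟩ := h
  let g : ZMod n → Bool := fun k => f ⟨v k, (hlink k).left_mem⟩
  have hg : ∀ k, g (k + 1) = !g k := by
    intro k
    have := hf ⟨v k, (hlink k).left_mem⟩ ⟨v (k + 1), (hlink k).right_mem⟩
      ((Graph.toSimpleGraph_adj_iff _ _).2 ⟨e k, hlink k⟩)
    exact Bool.eq_not.2 this.symm
  have hpow : ∀ m : ℕ, g m = (g 0 ^^ decide (Odd m)) := by
    intro m
    induction m with
    | zero => simp
    | succ m ih =>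
      rw [Nat.cast_succ, hg, ih]
      by_cases h : Odd m <;> simp [h, Nat.odd_add_one]
  have := hpow n
  rw [ZMod.natCast_self] at this
  simp [hn] at this

/-! ### The almost-extreme Khovanov homology -/

theorem mainTheorem4 (D : LinkDiagram) (hconn : D.Connected) (hA : D.AAdequate) :
    D.jAlmax = (D.c : ℤ) + 2 * D.numCirclesA - 4 ∧
    -- the almost-extreme Khovanov homology is the homology of the partial presimplicial set
    (∀ q : ℕ, Nonempty (D.Homology (2 * q - D.c) D.jAlmax ≃ₗ[ℤ]
      PartialPresimplicial.Homology D.graphA q)) ∧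
    -- the graph is bipartite
    (IsBipartiteGraph D.graphA →
      Nonempty (D.Homology D.c (D.c + 2 * D.numCirclesA - 4) ≃ₗ[ℤ] ℤ) ∧
      Nonempty (D.Homology (D.c - 2) (D.c + 2 * D.numCirclesA - 4) ≃ₗ[ℤ]
        (Fin (cyclomaticNumber D.graphA.toSimpleGraph) → ℤ)) ∧
      ∀ i : ℤ, i ≠ D.c → i ≠ D.c - 2 →
        Subsingleton (D.Homology i (D.c + 2 * D.numCirclesA - 4))) ∧
    -- the graph contains odd cycles
    (HasOddCycle D.graphA →
      (∃ r : ℕ, cyclomaticNumber D.graphA.toSimpleGraph = r + 1 ∧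
        Nonempty (D.Homology (D.c - 2) (D.c + 2 * D.numCirclesA - 4) ≃ₗ[ℤ]
          ((Fin r → ℤ) × ZMod 2))) ∧
      ∀ i : ℤ, i ≠ D.c - 2 →
        Subsingleton (D.Homology i (D.c + 2 * D.numCirclesA - 4))) := by
  classical
  have hloop : D.graphA.Loopless := hA
  have hH := LinkDiagram.connected_toSimpleGraph hconn hA
  have hE : D.graphA.edgeSet = Set.univ := rfl
  have hj := LinkDiagram.jAlmax_eq hA
  refine ⟨hj, fun q => hj ▸ LinkDiagram.homologyEquiv hA rfl, fun hb => ?_, fun ho => ?_⟩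
  · obtain ⟨⟨e1⟩, ⟨e2⟩⟩ :=
      hH.unsignedIncidence_of_bipartite (exists_coloring_of_isBipartiteGraph hb)
    refine ⟨?_, ?_, fun i h1 h2 => ?_⟩
    · obtain ⟨f⟩ := LinkDiagram.homologyEquiv hA (q := D.c) (i := D.c) (by ring)
      obtain ⟨g⟩ := PartialPresimplicial.homology_top (G := D.graphA) hE
      exact ⟨f.trans (g.trans e1)⟩
    · -- without crossings the index `c - 2` is below that of all the simplices, and `G` is a point
      by_cases hc : D.c = 0
      · have : IsEmpty D.graphA.toSimpleGraph.edgeSet := by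
          obtain ⟨cl, hcl, -⟩ := PartialPresimplicial.exists_edgeClass hE
          exact ⟨fun e => by obtain ⟨x, -⟩ := hcl e; have := x.2; omega⟩
        have hV : 0 < Nat.card D.graphA.vertexSet :=
          Nat.card_pos_iff.2 ⟨hH.nonempty, inferInstance⟩
        have h0 : cyclomaticNumber D.graphA.toSimpleGraph = 0 := by
          rw [hH.cyclomaticNumber_eq, Nat.card_of_isEmpty]
          omega
        have hsub : Subsingleton (D.Homology (D.c - 2) (D.c + 2 * D.numCirclesA - 4)) :=
          LinkDiagram.subsingleton_homology_of_forall_ne (fun q => by omega) _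
        rw [h0]
        exact ⟨0, 0, fun _ => Subsingleton.elim _ _, fun _ => Subsingleton.elim _ _⟩
      · obtain ⟨f⟩ := LinkDiagram.homologyEquiv hA (q := D.c - 1) (i := D.c - 2) (by omega)
        obtain ⟨g⟩ := PartialPresimplicial.homology_next (G := D.graphA) (q := D.c - 1) hE
          (by omega)
        exact ⟨f.trans (g.trans e2)⟩
    · exact LinkDiagram.subsingleton_homology_of_ne hA h1 h2
  · have hnb := not_exists_coloring_of_hasOddCycle ho
    obtain ⟨h0, r, hr, ⟨e2⟩⟩ := hH.unsignedIncidence_of_not_bipartite hnb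
    have hc : D.c ≠ 0 := by
      obtain ⟨n, hn, v, e, -⟩ := ho
      have := (e 0).2
      omega
    refine ⟨⟨r, hr, ?_⟩, fun i h2 => ?_⟩
    · obtain ⟨f⟩ := LinkDiagram.homologyEquiv hA (q := D.c - 1) (i := D.c - 2) (by omega)
      obtain ⟨g⟩ := PartialPresimplicial.homology_next (G := D.graphA) (q := D.c - 1) hE
        (by omega)
      exact ⟨f.trans (g.trans e2)⟩
    · by_cases h1 : i = D.c
      · obtain ⟨f⟩ := LinkDiagram.homologyEquiv hA (q := D.c) (i := i) (by omega)
        obtain ⟨g⟩ := PartialPresimplicial.homology_top (G := D.graphA) hE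
        exact (f.trans g).toEquiv.subsingleton
      · exact LinkDiagram.subsingleton_homology_of_ne hA h1 h2
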